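/- Let $M$ be a Markov decision process with finite nonempty state and action sets $S,A$, transition probabilities $P(s'\mid s,a)$, initial distribution $\rho$ and feature vectors $\phi(s,a)\in[0,1]^d$. Policies are stochastic, $\pi:S\to\mathcal P(A)$, and $P^\pi(s,s')=\sum_a\pi(a\mid s)P(s'\mid s,a)$. Assume that for every policy $\pi$ the law of the state at time $t$ converges as $t\to\infty$, to a limit independent of the initial state. Put $d_\pi(s)=\lim_t\Pr(s_t=s\mid s_0\sim\rho,\pi)$ and let $\psi^\pi=\sum_{s,a}d_\pi(s)\pi(a\mid s)\phi(s,a)\in\mathbb R^d$ be the successor features (SFs) of $\pi$. Let $D$ be the set of SFs of deterministic policies, $\|\cdot\|$ the Euclidean norm, $B_2$ its closed unit ball and $h(x)=\tfrac12\|x\|^2$. For policies $\pi^1,\pi^2,\dots$ put $\Psi^t=\{\psi^{\pi^1},\dots,\psi^{\pi^t}\}$. The \emph{worst-case-reward procedure} starts from a policy $\pi^1$ and, for $t\ge1$, picks $w_t\in\arg\min_{w\in B_2}\max_{\psi\in\Psi^t}w\cdot\psi$ and $\pi^{t+1}\in\arg\max_\pi\psi^\pi\cdot w_t$; its stopping test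 is $\psi^{\pi^{t+1}}\cdot w_t\le \bar v_t:=\min_{w\in B_2}\max_{\psi\in\Psi^t}w\cdot\psi$. \emph{Fully corrective Frank--Wolfe} for $f$ starts from a policy $\pi^1$ and, for $t\ge1$, picks $x_t\in\arg\min_{x\in\mathrm{Co}(\Psi^t)}f(x)$ and $\pi^{t+1}\in\arg\max_\pi\psi^\pi\cdot(-\nabla f(x_t))$. Ties are broken arbitrarily. Let $x_t$ be the minimizer of $h$ on $\mathrm{Co}(\Psi^t)$. Then: (1) $D$ is finite and $\{\psi^\pi:\pi\}=\mathrm{Co}(D)$ (the SF polytope). From every initial policy the worst-case-reward procedure has an infinite run in which all later policies are deterministic. (2) For every sequence of policies and $t\ge1$, $x_t$ exists and is unique, and $\bar v_t=-\|x_t\|$. If $x_t\ne0$, then $w=-x_t/\|x_t\|$ is the unique worst-case reward for $\Psi^t$, and $\psi^\pi\cdot w$ and $\psi^\pi\cdot(-x_t)$ have the same maximizing policies. (3) Let $\pi^1,\dots,\pi^T$ be policies such that $0\notin\mathrm{Co}(\Psi^t)$ for $1\le t<T$. They are successive iterates of the worst-case-reward procedure if and only if they are successive iterates of fully corrective Frank--Wolfe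 for $h$, and also if and only if they are successive iterates of fully corrective Frank--Wolfe for $f=\|\cdot\|$. (4) For every $t\ge1$, every worst-case reward $w_t$ for $\Psi^t$ and every $\pi^{t+1}\in\arg\max_\pi\psi^\pi\cdot w_t$: if $\psi^{\pi^{t+1}}\cdot w_t\le\bar v_t$, then $\|x_t\|=\min_\pi\|\psi^\pi\|$; the converse holds if $x_t\ne0$. (5) There is a constant $C$ depending only on $M$ such that for every $\varepsilon\in(0,\tfrac12]$, every run of the worst-case-reward procedure or of fully corrective Frank--Wolfe for $h$, and every iteration $t\ge1$ of that run with $t\ge C\log(1/\varepsilon)$, $x_t$ is $\varepsilon$-optimal: $\|x_t\|\le\min_\pi\|\psi^\pi\|+\varepsilon$ and $h(x_t)\le\min_\pi h(\psi^\pi)+\varepsilon$. (6) Let $\mathrm{diam}$ be the diameter of $\mathrm{Co}(D)$ and $\delta$ the pyramidal width of $D$: the infimum, over the faces $K$ of $\mathrm{Co}(D)$, the points $x\in K$, the directions $0\ne r\in\mathrm{cone}(K-x)$ and the sets $V\subseteq K\cap D$ such that $x$ is a convex combination with positive weights of all the elements of $V$, of $\max_{s\in K\cap D,\,v\in V}\langle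 r/\|r\|,s-v\rangle$. If $D$ has at least two points, then $\delta>0$. In every run as in (5) all of whose policies have SFs in $D$, the suboptimality $h_t=h(x_t)-\min_\pi h(\psi^\pi)$ satisfies $h_{t+1}\le\bigl(1-\delta^2/(4\,\mathrm{diam}^2)\bigr)h_t$ at every step $t\ge 1$ (with $0/0=0$). -/

import Mathlib

open Filter Topology
open scoped RealInnerProductSpace Matrix

noncomputable section

/-- A (stationary, stochastic) policy: a map from states to probability distributions on actions. -/
structure Policy (S A : Type*) [Fintype A] where
  prob : S → A → ℝ
  prob_mem : ∀ s, prob s ∈ stdSimplex ℝ A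

/-- A policy is deterministic if in every state some action has probability one. -/
def Policy.IsDeterministic {S A : Type*} [Fintype A] (π : Policy S A) : Prop :=
  ∀ s, ∃ a, π.prob s a = 1

/-- A finite Markov decision process with transition probabilities `trans s a s'`, an initial state
distribution, and a feature vector in `[0,1]^d` for every state-action pair.  (The rewards considered
are the linear ones `w ⬝ φ(s,a)`, and values are long-run averages, so there is no separate reward
function and no discount factor.) -/
structure FeatureMDP (S A : Type*) [Fintype S] (d : ℕ) where
  trans : S → A → S → ℝ
  trans_mem : ∀ s a, trans s a ∈ stdSimplex ℝ S
  init : S → ℝ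
  init_mem : init ∈ stdSimplex ℝ S
  feature : S → A → EuclideanSpace ℝ (Fin d)
  feature_mem : ∀ s a i, feature s a i ∈ Set.Icc (0 : ℝ) 1

namespace FeatureMDP

variable {S A : Type*} [Fintype S] [DecidableEq S] [Fintype A] {d : ℕ}

/-- The state transition matrix induced by a policy. -/
def transition (M : FeatureMDP S A d) (π : Policy S A) : Matrix S S ℝ :=
  Matrix.of fun s s' => ∑ a, π.prob s a * M.trans s a s'

/-- Standing assumption: under every policy the law of the state at time `t` converges, to a limit
that does not depend on the initial state. -/
def HasLimitDistributions (M : FeatureMDP S A d) : Prop :=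
  ∀ π : Policy S A, ∃ μ : S → ℝ, ∀ s₀ s : S,
    Tendsto (fun t : ℕ => (M.transition π ^ t) s₀ s) atTop (𝓝 (μ s))

/-- The stationary distribution `d_π(s) = lim_t Pr(s_t = s | s_0 ∼ init, π)`. -/
def stationaryDist (M : FeatureMDP S A d) (π : Policy S A) (s : S) : ℝ :=
  limUnder atTop fun t : ℕ => (M.init ᵥ* (M.transition π ^ t)) s

/-- The successor features of `π`: the expected features under its stationary distribution. -/
def sf (M : FeatureMDP S A d) (π : Policy S A) : EuclideanSpace ℝ (Fin d) :=
  ∑ s, ∑ a, (M.stationaryDist π s * π.prob s a) • M.feature s a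

/-- The successor features of the deterministic policies. -/
def detSF (M : FeatureMDP S A d) : Set (EuclideanSpace ℝ (Fin d)) :=
  {x | ∃ π : Policy S A, π.IsDeterministic ∧ M.sf π = x}

/-- `π` maximizes the linear reward `w` among all policies. -/
def IsGreedy (M : FeatureMDP S A d) (w : EuclideanSpace ℝ (Fin d)) (π : Policy S A) : Prop :=
  ∀ π' : Policy S A, ⟪M.sf π', w⟫ ≤ ⟪M.sf π, w⟫

/-- The set `Ψ^t = {ψ^1, …, ψ^t}` of successor features of the policies `π^1, …, π^t`. -/
def history (M : FeatureMDP S A d) (π : ℕ → Policy S A) (t : ℕ) :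
    Set (EuclideanSpace ℝ (Fin d)) :=
  (fun i => M.sf (π i)) '' Set.Icc 1 t

end FeatureMDP

/-- The value for the reward `w` of the set-max policy over `Ψ`: `max_{ψ ∈ Ψ} ψ ⬝ w`
(used for finite nonempty `Ψ`). -/
def setMaxValue {d : ℕ} (Ψ : Set (EuclideanSpace ℝ (Fin d))) (w : EuclideanSpace ℝ (Fin d)) : ℝ :=
  sSup ((fun ψ => ⟪ψ, w⟫) '' Ψ)

/-- `w ∈ argmin_{w ∈ B₂} max_{ψ ∈ Ψ} ψ ⬝ w`: a worst-case reward for the set-max policy. -/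
def IsWorstReward {d : ℕ} (Ψ : Set (EuclideanSpace ℝ (Fin d)))
    (w : EuclideanSpace ℝ (Fin d)) : Prop :=
  w ∈ Metric.closedBall (0 : EuclideanSpace ℝ (Fin d)) 1 ∧
    IsMinOn (setMaxValue Ψ) (Metric.closedBall 0 1) w

/-- The worst-case value of the set-max policy: `min_{w ∈ B₂} max_{ψ ∈ Ψ} ψ ⬝ w`. -/
def worstValue {d : ℕ} (Ψ : Set (EuclideanSpace ℝ (Fin d))) : ℝ :=
  sInf (setMaxValue Ψ '' Metric.closedBall 0 1)

/-- `x ∈ argmin_{x ∈ Co(Ψ)} f(x)`: the fully corrective step. -/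
def IsCorrective {d : ℕ} (f : EuclideanSpace ℝ (Fin d) → ℝ) (Ψ : Set (EuclideanSpace ℝ (Fin d)))
    (x : EuclideanSpace ℝ (Fin d)) : Prop :=
  x ∈ convexHull ℝ Ψ ∧ IsMinOn f (convexHull ℝ Ψ) x

/-- `h(x) = ‖x‖² / 2`. -/
def halfSq {d : ℕ} (x : EuclideanSpace ℝ (Fin d)) : ℝ := 1 / 2 * ‖x‖ ^ 2

namespace FeatureMDP

variable {S A : Type*} [Fintype S] [DecidableEq S] [Fintype A] {d : ℕ}

/-- `π^1, …, π^T` are successive policies of the iterative worst-case-reward procedure: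
`π^{t+1}` maximizes a worst-case reward for the set `{π^1, …, π^t}`. -/
def IsWorstCaseRun (M : FeatureMDP S A d) (π : ℕ → Policy S A) (T : ℕ) : Prop :=
  ∀ t, 1 ≤ t → t < T → ∃ w, IsWorstReward (M.history π t) w ∧ M.IsGreedy w (π (t + 1))

/-- `π^1, …, π^T` are successive policies of fully corrective Frank–Wolfe for `f`: `π^{t+1}`
maximizes the reward `-∇f(x)`, where `x` minimizes `f` over `Co{ψ^1, …, ψ^t}`. -/
def IsFrankWolfeRun (M : FeatureMDP S A d) (f : EuclideanSpace ℝ (Fin d) → ℝ)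
    (π : ℕ → Policy S A) (T : ℕ) : Prop :=
  ∀ t, 1 ≤ t → t < T →
    ∃ x, IsCorrective f (M.history π t) x ∧ M.IsGreedy (-gradient f x) (π (t + 1))

/-- `x` is `ε`-optimal for minimizing `f(ψ^π)` over all policies `π`. -/
def IsEpsOptimal (M : FeatureMDP S A d) (f : EuclideanSpace ℝ (Fin d) → ℝ) (ε : ℝ)
    (x : EuclideanSpace ℝ (Fin d)) : Prop :=
  ∀ π : Policy S A, f x ≤ f (M.sf π) + ε

/-- The suboptimality `h(x) - min_π h(ψ^π)` for `h = ‖·‖² / 2`. -/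
def subopt (M : FeatureMDP S A d) (x : EuclideanSpace ℝ (Fin d)) : ℝ :=
  halfSq x - ⨅ π : Policy S A, halfSq (M.sf π)

end FeatureMDP

section PyramidalWidth

variable {E : Type*} [NormedAddCommGroup E] [InnerProductSpace ℝ E]

/-- `x` is a proper convex combination (all weights positive) of all the elements of `V`. -/
def IsProperCombination (V : Finset E) (x : E) : Prop :=
  ∃ α : E → ℝ, (∀ v ∈ V, 0 < α v) ∧ ∑ v ∈ V, α v = 1 ∧ ∑ v ∈ V, α v • v = x

/-- Pyramidal directional width of the atom set `D` in direction `r` with base point `x`: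
`min_V max_{s ∈ D, v ∈ V} ⟨r / ‖r‖, s - v⟩`, the minimum being over the `V ⊆ D` such that `x` is a
proper convex combination of all the elements of `V`. -/
def pyramidalDirWidth (D : Set E) (r x : E) : ℝ :=
  sInf {δ | ∃ V : Finset E, (V : Set E) ⊆ D ∧ IsProperCombination V x ∧
    δ = sSup {c | ∃ s ∈ D, ∃ v ∈ V, c = ⟪‖r‖⁻¹ • r, s - v⟫}}

/-- Pyramidal width of `D`: the infimum of the pyramidal directional widths of `K ∩ D` over the faces
`K` of `Co(D)`, the base points `x ∈ K` and the directions `0 ≠ r ∈ cone(K - x)`. -/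
def pyramidalWidth (D : Set E) : ℝ :=
  sInf {δ | ∃ K : Set E, IsExposed ℝ (convexHull ℝ D) K ∧ ∃ x ∈ K, ∃ r : E, r ≠ 0 ∧
    (∃ c : ℝ, 0 ≤ c ∧ ∃ y ∈ K, r = c • (y - x)) ∧ δ = pyramidalDirWidth (K ∩ D) r x}

end PyramidalWidth

end

/-!
Everything rests on the point `x` of least norm in the convex hull of the successor features found
so far, and on its variational inequality `‖x‖² ≤ ⟨x, y⟩` for all `y` in the hull.

*The polytope.*  Since stationary distributions are unique, a state-action distribution that
satisfies the flow balance equations is the occupancy measure of the policy with its conditional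
action probabilities (`HasLimitDistributions.occupancy_eq`).  Hence the set of successor features is
a linear image of a convex set.  Conversely, an occupancy measure is a mixture of occupancy measures
of policies that are deterministic in one more state
(`HasLimitDistributions.sf_mem_convexHull_setAction`).

*Worst-case rewards.*  By the variational inequality and the Cauchy–Schwarz inequality, the
worst-case value is `-‖x‖`, attained at `-x / ‖x‖`, and only there when `x ≠ 0`
(`IsCorrective.isWorstReward_iff_eq`).  Up to a positive factor, this is also the reward
`-∇f(x)` for `f = ‖·‖² / 2` and for `f = ‖·‖`, so the algorithms have the same iterates and the
stopping test is the variational inequality over the whole polytope.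

*Iteration bound.*  Both algorithms reach the exact optimum after boundedly many steps: the face of
the polytope on which `⟨x_t, ·⟩` is minimal cannot recur before optimality
(`HasLimitDistributions.isEpsOptimal_of_two_pow_card_lt`).  As `log (1 / ε) ≥ log 2`, this yields
the bound `C log (1 / ε)`.  The argument also covers runs through successor features that are not
vertices, to which the pyramidal width does not apply.

*Geometric decrease.*  The pyramidal width is positive because, for fixed sets of atoms, the
feasible directions lie in a closed cone on whose nonzero elements `max ⟨r, s - v⟩` is positive
(`exists_pos_le_inner_sub`).
Projecting onto the polytope shows that it controls the pairwise gap in every direction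
(`pyramidalWidth_mul_inner_le`).  For a fully corrective method the pairwise gap is the Frank–Wolfe
gap, and a line search towards the new atom gives the contraction
(`HasLimitDistributions.subopt_step`).
-/

noncomputable section

namespace FeatureMDP

variable {S A : Type*} [Fintype S] [DecidableEq S] [Fintype A] {d : ℕ}

/-! ### Stationary distributions -/

omit [DecidableEq S] in
lemma transition_apply (M : FeatureMDP S A d) (π : Policy S A) (s s' : S) :
    M.transition π s s' = ∑ a, π.prob s a * M.trans s a s' := rfl

omit [DecidableEq S] in
lemma vecMul_transition_mem (M : FeatureMDP S A d) (π : Policy S A) {μ : S → ℝ}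
    (hμ : μ ∈ stdSimplex ℝ S) : μ ᵥ* M.transition π ∈ stdSimplex ℝ S := by
  refine ⟨fun s' => Finset.sum_nonneg fun s _ => mul_nonneg (hμ.1 s) <|
    Finset.sum_nonneg fun a _ => mul_nonneg ((π.prob_mem s).1 a) ((M.trans_mem s a).1 s'), ?_⟩
  have h1 : ∀ s, ∑ s', M.transition π s s' = 1 := fun s => by
    simp_rw [transition_apply]
    rw [Finset.sum_comm]
    simp_rw [← Finset.mul_sum, (M.trans_mem s _).2, mul_one]
    exact (π.prob_mem s).2
  simp only [Matrix.vecMul, dotProduct]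
  rw [Finset.sum_comm]
  simp_rw [← Finset.mul_sum, h1, mul_one]
  exact hμ.2

lemma vecMul_transition_pow_mem (M : FeatureMDP S A d) (π : Policy S A) {μ : S → ℝ}
    (hμ : μ ∈ stdSimplex ℝ S) (t : ℕ) : μ ᵥ* M.transition π ^ t ∈ stdSimplex ℝ S := by
  induction t with
  | zero => simpa using hμ
  | succ t ih =>
    rw [pow_succ, ← Matrix.vecMul_vecMul]
    exact M.vecMul_transition_mem π ih

/-- From every initial distribution the law of the state converges to `stationaryDist`: the limit
does not depend on the initial state, hence not on the initial distribution either. -/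
lemma HasLimitDistributions.tendsto_vecMul {M : FeatureMDP S A d} (hM : M.HasLimitDistributions)
    (π : Policy S A) {μ : S → ℝ} (hμ : μ ∈ stdSimplex ℝ S) :
    Tendsto (fun t : ℕ => μ ᵥ* M.transition π ^ t) atTop (𝓝 (M.stationaryDist π)) := by
  obtain ⟨L, hL⟩ := hM π
  have key : ∀ ν ∈ stdSimplex ℝ S, ∀ s,
      Tendsto (fun t : ℕ => (ν ᵥ* M.transition π ^ t) s) atTop (𝓝 (L s)) := fun ν hν s => by
    have h : Tendsto (fun t : ℕ => ∑ s₀, ν s₀ * (M.transition π ^ t) s₀ s) atTop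
        (𝓝 (∑ s₀, ν s₀ * L s)) :=
      tendsto_finsetSum _ fun s₀ _ => (hL s₀ s).const_mul _
    rwa [← Finset.sum_mul, hν.2, one_mul] at h
  have hL' : M.stationaryDist π = L := funext fun s => (key _ M.init_mem s).limUnder_eq
  rw [hL', tendsto_pi_nhds]
  exact key μ hμ

lemma HasLimitDistributions.stationaryDist_mem {M : FeatureMDP S A d}
    (hM : M.HasLimitDistributions) (π : Policy S A) :
    M.stationaryDist π ∈ stdSimplex ℝ S :=
  (isClosed_stdSimplex ℝ S).mem_of_tendsto (hM.tendsto_vecMul π M.init_mem)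
    (Eventually.of_forall fun t => M.vecMul_transition_pow_mem π M.init_mem t)

lemma HasLimitDistributions.stationaryDist_vecMul {M : FeatureMDP S A d}
    (hM : M.HasLimitDistributions) (π : Policy S A) :
    M.stationaryDist π ᵥ* M.transition π = M.stationaryDist π := by
  have h1 := (tendsto_add_atTop_iff_nat 1).2 (hM.tendsto_vecMul π M.init_mem)
  have h2 : Tendsto (fun t : ℕ => M.init ᵥ* M.transition π ^ (t + 1)) atTop
      (𝓝 (M.stationaryDist π ᵥ* M.transition π)) := by
    simp_rw [pow_succ, ← Matrix.vecMul_vecMul]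
    have hc : Continuous fun v : S → ℝ => v ᵥ* M.transition π :=
      continuous_id.matrix_vecMul continuous_const
    exact (hc.tendsto _).comp (hM.tendsto_vecMul π M.init_mem)
  exact tendsto_nhds_unique h2 h1

lemma HasLimitDistributions.eq_stationaryDist {M : FeatureMDP S A d}
    (hM : M.HasLimitDistributions) (π : Policy S A) {μ : S → ℝ} (hμ : μ ∈ stdSimplex ℝ S)
    (h : μ ᵥ* M.transition π = μ) : M.stationaryDist π = μ := by
  have hp : ∀ t : ℕ, μ ᵥ* M.transition π ^ t = μ := fun t => by
    induction t with
    | zero => simp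
    | succ t ih => rw [pow_succ, ← Matrix.vecMul_vecMul, ih, h]
  have := hM.tendsto_vecMul π hμ
  simp_rw [hp] at this
  exact tendsto_nhds_unique this tendsto_const_nhds

/-! ### Occupancy measures -/

/-- The occupancy measure of `π`: the long-run frequency of each state-action pair. -/
def occupancy (M : FeatureMDP S A d) (π : Policy S A) (s : S) (a : A) : ℝ :=
  M.stationaryDist π s * π.prob s a

/-- The polytope of state-action distributions that satisfy the flow balance equations. -/
def flowPolytope (M : FeatureMDP S A d) : Set (S → A → ℝ) :=
  {x | (∀ s a, 0 ≤ x s a) ∧ ∑ s, ∑ a, x s a = 1 ∧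
    ∀ s', ∑ s, ∑ a, x s a * M.trans s a s' = ∑ a, x s' a}

/-- Expected features under a state-action distribution. -/
def featureMean (M : FeatureMDP S A d) : (S → A → ℝ) →ₗ[ℝ] EuclideanSpace ℝ (Fin d) where
  toFun x := ∑ s, ∑ a, x s a • M.feature s a
  map_add' x y := by simp [add_smul, Finset.sum_add_distrib]
  map_smul' c x := by simp [mul_smul, Finset.smul_sum]

lemma featureMean_occupancy (M : FeatureMDP S A d) (π : Policy S A) :
    M.featureMean (M.occupancy π) = M.sf π := rfl

lemma sum_occupancy (M : FeatureMDP S A d) (π : Policy S A) (s : S) :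
    ∑ a, M.occupancy π s a = M.stationaryDist π s := by
  simp only [occupancy, ← Finset.mul_sum, (π.prob_mem s).2, mul_one]

omit [DecidableEq S] in
lemma vecMul_transition_apply (M : FeatureMDP S A d) (π : Policy S A) (μ : S → ℝ) (s' : S) :
    (μ ᵥ* M.transition π) s' = ∑ s, ∑ a, μ s * π.prob s a * M.trans s a s' := by
  simp only [Matrix.vecMul, dotProduct, transition_apply, Finset.mul_sum, mul_assoc]

lemma HasLimitDistributions.occupancy_mem {M : FeatureMDP S A d} (hM : M.HasLimitDistributions)
    (π : Policy S A) : M.occupancy π ∈ M.flowPolytope := by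
  have hd := hM.stationaryDist_mem π
  refine ⟨fun s a => mul_nonneg (hd.1 s) ((π.prob_mem s).1 a), ?_, fun s' => ?_⟩
  · simp_rw [sum_occupancy]
    exact hd.2
  · rw [sum_occupancy, ← congrFun (hM.stationaryDist_vecMul π) s', vecMul_transition_apply]
    rfl

/-- A flow whose conditional action probabilities are those of `π` is the occupancy measure of
`π`, because the stationary distribution is unique. -/
lemma HasLimitDistributions.occupancy_eq {M : FeatureMDP S A d} (hM : M.HasLimitDistributions)
    {x : S → A → ℝ} (hx : x ∈ M.flowPolytope) {π : Policy S A}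
    (h : ∀ s a, x s a = (∑ b, x s b) * π.prob s a) : M.occupancy π = x := by
  have hd : M.stationaryDist π = fun s => ∑ b, x s b := by
    refine hM.eq_stationaryDist π ⟨fun s => Finset.sum_nonneg fun b _ => hx.1 s b, hx.2.1⟩ ?_
    funext s'
    rw [vecMul_transition_apply, ← hx.2.2 s']
    exact Finset.sum_congr rfl fun s _ => Finset.sum_congr rfl fun a _ => by rw [← h s a]
  funext s a
  rw [occupancy, hd, ← h s a]

omit [DecidableEq S] in
lemma convex_flowPolytope (M : FeatureMDP S A d) : Convex ℝ M.flowPolytope := by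
  intro x hx y hy a b ha hb hab
  refine ⟨fun s i => ?_, ?_, fun s' => ?_⟩
  · exact add_nonneg (mul_nonneg ha (hx.1 s i)) (mul_nonneg hb (hy.1 s i))
  · simp [Finset.sum_add_distrib, ← Finset.mul_sum, hx.2.1, hy.2.1, hab]
  · simp only [Pi.add_apply, Pi.smul_apply, smul_eq_mul, add_mul, Finset.sum_add_distrib,
      ← Finset.mul_sum, mul_assoc, hx.2.2, hy.2.2]

omit [DecidableEq S] in
/-- Every flow has a policy with its conditional action probabilities; where a state carries no
mass, any action distribution does. -/
lemma exists_policy_of_mem_flowPolytope [Nonempty A] {M : FeatureMDP S A d} {x : S → A → ℝ}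
    (hx : x ∈ M.flowPolytope) :
    ∃ π : Policy S A, ∀ s a, x s a = (∑ b, x s b) * π.prob s a := by
  classical
  have : ∀ s, ∃ p ∈ stdSimplex ℝ A, ∀ a, x s a = (∑ b, x s b) * p a := fun s => by
    by_cases h0 : ∑ b, x s b = 0
    · refine ⟨_, single_mem_stdSimplex ℝ (Classical.arbitrary A), fun a => ?_⟩
      rw [h0, zero_mul]
      exact (Finset.sum_eq_zero_iff_of_nonneg fun b _ => hx.1 s b).1 h0 a (Finset.mem_univ a)
    · have hpos : 0 ≤ ∑ b, x s b := Finset.sum_nonneg fun b _ => hx.1 s b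
      refine ⟨fun a => x s a / ∑ b, x s b, ⟨fun a => div_nonneg (hx.1 s a) hpos, ?_⟩, fun a => ?_⟩
      · rw [← Finset.sum_div, div_self h0]
      · rw [mul_div_cancel₀ _ h0]
  choose p hp hp' using this
  exact ⟨⟨p, hp⟩, hp'⟩

lemma HasLimitDistributions.range_sf_eq_image [Nonempty A] {M : FeatureMDP S A d}
    (hM : M.HasLimitDistributions) : Set.range M.sf = M.featureMean '' M.flowPolytope := by
  ext ψ
  constructor
  · rintro ⟨π, rfl⟩
    exact ⟨_, hM.occupancy_mem π, M.featureMean_occupancy π⟩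
  · rintro ⟨x, hx, rfl⟩
    obtain ⟨π, hπ⟩ := exists_policy_of_mem_flowPolytope hx
    exact ⟨π, by rw [← featureMean_occupancy, hM.occupancy_eq hx hπ]⟩

end FeatureMDP

/-! ### Deterministic policies span the polytope of successor features -/

section Policies

variable {S A : Type*} [Fintype A]

open Classical in
/-- The deterministic policy that plays `f s` in state `s`. -/
def Policy.ofFun (f : S → A) : Policy S A where
  prob s := Pi.single (f s) 1
  prob_mem s := single_mem_stdSimplex ℝ (f s)

open Classical in
/-- The policy `π`, changed to play `a` in state `s`. -/
def Policy.setAction (π : Policy S A) (s : S) (a : A) : Policy S A where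
  prob := Function.update π.prob s (Pi.single a 1)
  prob_mem s' := by
    by_cases h : s' = s
    · subst h
      simpa using single_mem_stdSimplex ℝ a
    · simpa [h] using π.prob_mem s'

lemma Policy.setAction_prob_of_ne (π : Policy S A) {s s' : S} (h : s' ≠ s) (a : A) :
    (π.setAction s a).prob s' = π.prob s' := by
  simp [setAction, h]

open Classical in
lemma Policy.setAction_prob_self (π : Policy S A) (s : S) (a : A) :
    (π.setAction s a).prob s = Pi.single a 1 := by
  simp [setAction]

lemma Policy.ofFun_isDeterministic (f : S → A) : (Policy.ofFun f).IsDeterministic :=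
  fun s => ⟨f s, by simp [ofFun]⟩

lemma Policy.IsDeterministic.exists_eq_ofFun {π : Policy S A} (h : π.IsDeterministic) :
    ∃ f, Policy.ofFun f = π := by
  classical
  choose f hf using h
  refine ⟨f, ?_⟩
  have : (ofFun f).prob = π.prob := by
    funext s a
    by_cases ha : a = f s
    · subst ha
      simp [ofFun, hf]
    · have hs := (π.prob_mem s).2
      rw [← Finset.add_sum_erase _ _ (Finset.mem_univ (f s)), hf, add_eq_left,
        Finset.sum_eq_zero_iff_of_nonneg fun b _ => (π.prob_mem s).1 b] at hs
      simp [ofFun, ha, hs a (by simpa using ha)]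
  cases π
  cases this
  rfl

end Policies

namespace FeatureMDP

variable {S A : Type*} [Fintype S] [DecidableEq S] [Fintype A] {d : ℕ}

lemma finite_detSF (M : FeatureMDP S A d) : M.detSF.Finite := by
  refine (Set.finite_range fun f : S → A => M.sf (Policy.ofFun f)).subset ?_
  rintro _ ⟨π, hπ, rfl⟩
  obtain ⟨f, rfl⟩ := hπ.exists_eq_ofFun
  exact ⟨f, rfl⟩

lemma detSF_nonempty [Nonempty A] (M : FeatureMDP S A d) : M.detSF.Nonempty :=
  ⟨_, _, Policy.ofFun_isDeterministic fun _ => Classical.arbitrary A, rfl⟩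

/-- Making one state deterministic: the occupancy measure of `π` is a mixture of those of the
policies that play a fixed action in `s`.  The weights are `π(a|s)`, corrected by the frequency of
visits to `s`; a policy under which `s` is not visited has the same occupancy measure as `π`. -/
lemma HasLimitDistributions.sf_mem_convexHull_setAction [Nonempty A] {M : FeatureMDP S A d}
    (hM : M.HasLimitDistributions) (π : Policy S A) (s : S) :
    M.sf π ∈ convexHull ℝ (Set.range fun a => M.sf (π.setAction s a)) := by
  classical
  set μ : A → S → ℝ := fun a => M.stationaryDist (π.setAction s a) with hμ
  set x : A → S → A → ℝ := fun a => M.occupancy (π.setAction s a) with hx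
  have hxμ : ∀ a s', ∑ b, x a s' b = μ a s' := fun a s' => M.sum_occupancy _ s'
  have hxs : ∀ a b, x a s b = if b = a then μ a s else 0 := fun a b => by
    simp [hx, hμ, occupancy, Policy.setAction_prob_self, Pi.single_apply]
  have hxn : ∀ a s' b, s' ≠ s → x a s' b = μ a s' * π.prob s' b := fun a s' b h => by
    simp [hx, hμ, occupancy, Policy.setAction_prob_of_ne _ h]
  have hx0 : ∀ a, x a ∈ M.flowPolytope := fun a => hM.occupancy_mem _
  by_cases h : ∃ a, μ a s = 0
  · obtain ⟨a, ha⟩ := h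
    refine subset_convexHull ℝ _ ⟨a, ?_⟩
    have : M.occupancy π = x a := hM.occupancy_eq (hx0 a) fun s' b => by
      rw [hxμ]
      by_cases hs : s' = s
      · subst hs
        simp [hxs, ha]
      · exact hxn a s' b hs
    change M.sf _ = _
    rw [← featureMean_occupancy, ← featureMean_occupancy, this]
  · push Not at h
    have hpos : ∀ a, 0 < μ a s := fun a => ((hM.stationaryDist_mem _).1 s).lt_of_ne' (h a)
    set Z := ∑ a, π.prob s a / μ a s
    have hZ0 : ∀ a, 0 ≤ π.prob s a / μ a s := fun a =>
      div_nonneg ((π.prob_mem s).1 a) (hpos a).le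
    have hZpos : 0 < Z := by
      refine (Finset.sum_nonneg fun a _ => hZ0 a).lt_of_ne' fun h0 => ?_
      rw [Finset.sum_eq_zero_iff_of_nonneg fun a _ => hZ0 a] at h0
      have h1 := (π.prob_mem s).2
      rw [Finset.sum_eq_zero] at h1
      · exact zero_ne_one h1
      · intro a ha
        simpa [h a] using h0 a ha
    set w : A → ℝ := fun a => π.prob s a / μ a s / Z with hw
    have hw0 : ∀ a, 0 ≤ w a := fun a => div_nonneg (hZ0 a) hZpos.le
    have hw1 : ∑ a, w a = 1 := by rw [← Finset.sum_div, div_self hZpos.ne']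
    have hwμ : ∀ a, w a * μ a s = π.prob s a / Z := fun a => by
      have := h a
      simp only [hw]
      field_simp
    have hocc : M.occupancy π = ∑ a, w a • x a := by
      refine hM.occupancy_eq (M.convex_flowPolytope.sum_mem (fun a _ => hw0 a) hw1
        fun a _ => hx0 a) fun s' b => ?_
      have hsum : ∑ c, (∑ a, w a • x a) s' c = ∑ a, w a * μ a s' := by
        simp only [Finset.sum_apply, Pi.smul_apply, smul_eq_mul]
        rw [Finset.sum_comm]
        simp_rw [← Finset.mul_sum, hxμ]
      rw [hsum]
      simp only [Finset.sum_apply, Pi.smul_apply, smul_eq_mul]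
      by_cases hs : s' = s
      · subst hs
        simp only [hxs, mul_ite, mul_zero, Finset.sum_ite_eq, Finset.mem_univ, if_true, hwμ,
          ← Finset.sum_div, (π.prob_mem s').2]
        ring
      · simp_rw [hxn _ _ _ hs, ← mul_assoc, ← Finset.sum_mul]
    rw [← featureMean_occupancy, hocc, map_sum]
    simp_rw [map_smul]
    exact (convex_convexHull ℝ _).sum_mem (fun a _ => hw0 a) hw1
      fun a _ => subset_convexHull ℝ _ ⟨a, rfl⟩

lemma HasLimitDistributions.sf_mem_convexHull_detSF [Nonempty A] {M : FeatureMDP S A d}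
    (hM : M.HasLimitDistributions) (π : Policy S A) : M.sf π ∈ convexHull ℝ M.detSF := by
  -- induction on the set of states in which the policy may still randomize
  have : ∀ (F : Finset S) (π : Policy S A), (∀ s ∉ F, ∃ a, π.prob s a = 1) →
      M.sf π ∈ convexHull ℝ M.detSF := fun F => by
    classical
    induction F using Finset.induction_on with
    | empty => exact fun π h => subset_convexHull ℝ _ ⟨π, fun s => h s (by simp), rfl⟩
    | insert s F _ ih =>
      intro π h
      refine convexHull_min ?_ (convex_convexHull ℝ _) (hM.sf_mem_convexHull_setAction π s)
      rintro _ ⟨a, rfl⟩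
      refine ih _ fun s' hs' => ?_
      by_cases hss : s' = s
      · subst hss
        exact ⟨a, by simp [Policy.setAction_prob_self]⟩
      · rw [Policy.setAction_prob_of_ne _ hss]
        exact h s' (by simp [hss, hs'])
  exact this Finset.univ π (by simp)

lemma HasLimitDistributions.range_sf [Nonempty A] {M : FeatureMDP S A d}
    (hM : M.HasLimitDistributions) : Set.range M.sf = convexHull ℝ M.detSF := by
  refine Set.Subset.antisymm (Set.range_subset_iff.2 hM.sf_mem_convexHull_detSF)
    (convexHull_min ?_ ?_)
  · rintro _ ⟨π, -, rfl⟩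
    exact ⟨π, rfl⟩
  · rw [hM.range_sf_eq_image]
    exact M.convex_flowPolytope.linear_image _

end FeatureMDP

/-! ### Points of minimal norm -/

section MinNorm

variable {E : Type*} [NormedAddCommGroup E] [InnerProductSpace ℝ E]

/-- The variational inequality for the point of least norm of a convex set. -/
lemma sq_norm_le_inner_of_forall_norm_le {K : Set E} (hK : Convex ℝ K) {x : E} (hx : x ∈ K)
    (h : ∀ y ∈ K, ‖x‖ ≤ ‖y‖) {y : E} (hy : y ∈ K) : ‖x‖ ^ 2 ≤ ⟪x, y⟫ := by
  have : Nonempty K := ⟨⟨x, hx⟩⟩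
  have h0 : ‖(0 : E) - x‖ = ⨅ w : K, ‖(0 : E) - w‖ := by
    simp only [zero_sub, norm_neg]
    exact le_antisymm (le_ciInf fun w => h w w.2)
      (ciInf_le (f := fun w : K => ‖(w : E)‖) ⟨0, by rintro _ ⟨w, rfl⟩; positivity⟩ ⟨x, hx⟩)
  have := (norm_eq_iInf_iff_real_inner_le_zero hK hx).1 h0 y hy
  rw [zero_sub, inner_neg_left, inner_sub_right, real_inner_self_eq_norm_sq] at this
  linarith

lemma norm_le_of_sq_norm_le_inner {x y : E} (h : ‖x‖ ^ 2 ≤ ⟪x, y⟫) : ‖x‖ ≤ ‖y‖ := by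
  rcases eq_or_ne x 0 with rfl | hx
  · simp
  · have h1 := real_inner_le_norm x y
    have h2 : 0 < ‖x‖ := norm_pos_iff.2 hx
    nlinarith

/-- A linear functional is bounded on a convex hull by its bound on the generators. -/
lemma inner_le_of_mem_convexHull {Ψ : Set E} {w : E} {c : ℝ} (h : ∀ ψ ∈ Ψ, ⟪ψ, w⟫ ≤ c) {y : E}
    (hy : y ∈ convexHull ℝ Ψ) : ⟪y, w⟫ ≤ c := by
  have hc : Convex ℝ {y : E | ⟪y, w⟫ ≤ c} := by
    intro a ha b hb s t hs ht hst
    simp only [Set.mem_ofPred_eq, inner_add_left, real_inner_smul_left] at *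
    calc s * ⟪a, w⟫ + t * ⟪b, w⟫ ≤ s * c + t * c := by gcongr
      _ = c := by rw [← add_mul, hst, one_mul]
  exact convexHull_min h hc hy

end MinNorm

/-! ### Corrective steps and worst-case rewards -/

section WorstReward

variable {d : ℕ} {Ψ : Set (EuclideanSpace ℝ (Fin d))} {x y w : EuclideanSpace ℝ (Fin d)}

lemma halfSq_le_halfSq : halfSq x ≤ halfSq y ↔ ‖x‖ ≤ ‖y‖ := by
  rw [halfSq, halfSq, mul_le_mul_iff_right₀ (by norm_num),
    pow_le_pow_iff_left₀ (norm_nonneg _) (norm_nonneg _) two_ne_zero]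

lemma isCorrective_halfSq_iff :
    IsCorrective halfSq Ψ x ↔ x ∈ convexHull ℝ Ψ ∧ ∀ y ∈ convexHull ℝ Ψ, ‖x‖ ≤ ‖y‖ := by
  simp only [IsCorrective, isMinOn_iff, halfSq_le_halfSq]

lemma isCorrective_norm_iff : IsCorrective (fun x => ‖x‖) Ψ x ↔ IsCorrective halfSq Ψ x := by
  rw [isCorrective_halfSq_iff]
  simp only [IsCorrective, isMinOn_iff]

lemma IsCorrective.norm_le (hx : IsCorrective halfSq Ψ x) (hy : y ∈ convexHull ℝ Ψ) :
    ‖x‖ ≤ ‖y‖ :=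
  (isCorrective_halfSq_iff.1 hx).2 y hy

lemma IsCorrective.sq_norm_le_inner (hx : IsCorrective halfSq Ψ x) (hy : y ∈ convexHull ℝ Ψ) :
    ‖x‖ ^ 2 ≤ ⟪x, y⟫ :=
  sq_norm_le_inner_of_forall_norm_le (convex_convexHull ℝ Ψ) hx.1 (fun _ => hx.norm_le) hy

lemma IsCorrective.unique (hx : IsCorrective halfSq Ψ x) (hy : IsCorrective halfSq Ψ y) :
    x = y := by
  have h1 := hx.sq_norm_le_inner hy.1
  have h2 := hy.sq_norm_le_inner hx.1
  have h3 := norm_sub_sq_real x y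
  rw [real_inner_comm] at h2
  have h4 : ‖x - y‖ ^ 2 = 0 := le_antisymm (by linarith) (by positivity)
  rwa [sq_eq_zero_iff, norm_eq_zero, sub_eq_zero] at h4

lemma exists_isCorrective_halfSq (hΨ : Ψ.Finite) (hne : Ψ.Nonempty) :
    ∃ x, IsCorrective halfSq Ψ x := by
  have hc : Continuous (halfSq : EuclideanSpace ℝ (Fin d) → ℝ) := by
    unfold halfSq
    fun_prop
  exact (hΨ.isCompact_convexHull ℝ).exists_isMinOn (hne.convexHull) hc.continuousOn

lemma inner_le_setMaxValue (hΨ : Ψ.Finite) (hy : y ∈ convexHull ℝ Ψ) :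
    ⟪y, w⟫ ≤ setMaxValue Ψ w :=
  inner_le_of_mem_convexHull
    (fun _ hψ => le_csSup (hΨ.image _).bddAbove (Set.mem_image_of_mem _ hψ)) hy

lemma setMaxValue_le (hne : Ψ.Nonempty) {c : ℝ} (h : ∀ ψ ∈ Ψ, ⟪ψ, w⟫ ≤ c) :
    setMaxValue Ψ w ≤ c :=
  csSup_le (hne.image _) (by rintro _ ⟨_, hψ, rfl⟩; exact h _ hψ)

/-- The reward `-x / ‖x‖` attains the value `-‖x‖`.  With `0⁻¹ = 0` this also holds at the origin,
where the reward is `0`. -/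
lemma IsCorrective.setMaxValue_neg_normalize_le (hne : Ψ.Nonempty)
    (hx : IsCorrective halfSq Ψ x) : setMaxValue Ψ (-(‖x‖⁻¹ • x)) ≤ -‖x‖ := by
  refine setMaxValue_le hne fun ψ hψ => ?_
  have h := hx.sq_norm_le_inner (subset_convexHull ℝ _ hψ)
  rw [inner_neg_right, real_inner_smul_right, real_inner_comm, neg_le_neg_iff]
  calc ‖x‖ = ‖x‖⁻¹ * ‖x‖ ^ 2 := by
        rcases eq_or_ne ‖x‖ 0 with h0 | h0
        · simp [h0]
        · field_simp
    _ ≤ ‖x‖⁻¹ * ⟪x, ψ⟫ := by gcongr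

lemma norm_neg_normalize_le (x : EuclideanSpace ℝ (Fin d)) : ‖-(‖x‖⁻¹ • x)‖ ≤ 1 := by
  rw [norm_neg, norm_smul, norm_inv, norm_norm]
  exact inv_mul_le_one

lemma IsCorrective.neg_norm_le_setMaxValue (hΨ : Ψ.Finite) (hx : IsCorrective halfSq Ψ x)
    (hw : ‖w‖ ≤ 1) : -‖x‖ ≤ setMaxValue Ψ w := by
  refine le_trans ?_ (inner_le_setMaxValue hΨ hx.1)
  have h := (abs_le.1 (abs_real_inner_le_norm x w)).1
  nlinarith [norm_nonneg x]

/-- Minimax duality: the worst-case value is minus the distance of `Co(Ψ)` from the origin. -/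
lemma IsCorrective.worstValue_eq (hΨ : Ψ.Finite) (hne : Ψ.Nonempty)
    (hx : IsCorrective halfSq Ψ x) : worstValue Ψ = -‖x‖ := by
  refine IsLeast.csInf_eq ⟨⟨_, mem_closedBall_zero_iff.2 (norm_neg_normalize_le x),
    le_antisymm (hx.setMaxValue_neg_normalize_le hne)
      (hx.neg_norm_le_setMaxValue hΨ (norm_neg_normalize_le x))⟩, ?_⟩
  rintro _ ⟨w, hw, rfl⟩
  exact hx.neg_norm_le_setMaxValue hΨ (mem_closedBall_zero_iff.1 hw)

lemma IsCorrective.isWorstReward_iff (hΨ : Ψ.Finite) (hne : Ψ.Nonempty)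
    (hx : IsCorrective halfSq Ψ x) :
    IsWorstReward Ψ w ↔ ‖w‖ ≤ 1 ∧ setMaxValue Ψ w ≤ -‖x‖ := by
  simp only [IsWorstReward, isMinOn_iff, mem_closedBall_zero_iff]
  refine and_congr_right fun _ => ⟨fun h => ?_, fun h v hv => ?_⟩
  · exact (h _ (norm_neg_normalize_le x)).trans (hx.setMaxValue_neg_normalize_le hne)
  · exact h.trans (hx.neg_norm_le_setMaxValue hΨ hv)

lemma IsCorrective.isWorstReward_neg_normalize (hΨ : Ψ.Finite) (hne : Ψ.Nonempty)
    (hx : IsCorrective halfSq Ψ x) : IsWorstReward Ψ (-(‖x‖⁻¹ • x)) :=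
  (hx.isWorstReward_iff hΨ hne).2
    ⟨norm_neg_normalize_le x, hx.setMaxValue_neg_normalize_le hne⟩

lemma exists_isWorstReward (hΨ : Ψ.Finite)
    (hne : Ψ.Nonempty) : ∃ w, IsWorstReward Ψ w := by
  obtain ⟨x, hx⟩ := exists_isCorrective_halfSq hΨ hne
  exact ⟨_, hx.isWorstReward_neg_normalize hΨ hne⟩

/-- Away from the origin the worst-case reward is unique, by the equality case of the
Cauchy–Schwarz inequality. -/
lemma IsCorrective.isWorstReward_iff_eq (hΨ : Ψ.Finite) (hne : Ψ.Nonempty)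
    (hx : IsCorrective halfSq Ψ x) (hx0 : x ≠ 0) :
    IsWorstReward Ψ w ↔ w = -(‖x‖⁻¹ • x) := by
  refine ⟨fun h => ?_, fun h => h ▸ hx.isWorstReward_neg_normalize hΨ hne⟩
  obtain ⟨hw, hm⟩ := (hx.isWorstReward_iff hΨ hne).1 h
  have h1 : ⟪x, w⟫ ≤ -‖x‖ := (inner_le_setMaxValue hΨ hx.1).trans hm
  have hpos : 0 < ‖x‖ := norm_pos_iff.2 hx0
  have h2 : ‖w + ‖x‖⁻¹ • x‖ ^ 2 ≤ 0 := by
    rw [norm_add_sq_real, real_inner_smul_right, norm_smul, norm_inv, norm_norm,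
      inv_mul_cancel₀ hpos.ne', real_inner_comm]
    have h3 : ‖x‖⁻¹ * ⟪x, w⟫ ≤ -1 := by
      calc ‖x‖⁻¹ * ⟪x, w⟫ ≤ ‖x‖⁻¹ * -‖x‖ := by gcongr
        _ = -1 := by field_simp
    nlinarith [norm_nonneg w]
  have h4 := pow_eq_zero_iff two_ne_zero |>.1 (le_antisymm h2 (by positivity))
  exact eq_neg_of_add_eq_zero_left (norm_eq_zero.1 h4)

lemma gradient_halfSq (x : EuclideanSpace ℝ (Fin d)) : gradient halfSq x = x := by
  have h := (hasStrictFDerivAt_norm_sq x).hasFDerivAt.const_mul (1 / 2 : ℝ)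
  refine HasGradientAt.gradient (hasGradientAt_iff_hasFDerivAt.2 (h.congr_fderiv ?_))
  ext v
  simp

lemma gradient_norm {x : EuclideanSpace ℝ (Fin d)} (hx : x ≠ 0) :
    gradient (fun y : EuclideanSpace ℝ (Fin d) => ‖y‖) x = ‖x‖⁻¹ • x := by
  have hpos : 0 < ‖x‖ := norm_pos_iff.2 hx
  have h := (hasStrictFDerivAt_norm_sq x).hasFDerivAt.sqrt (by positivity)
  simp only [Real.sqrt_sq (norm_nonneg _)] at h
  refine HasGradientAt.gradient (hasGradientAt_iff_hasFDerivAt.2 (h.congr_fderiv ?_))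
  ext v
  simp
  field_simp

end WorstReward

/-! ### Greedy policies and the iterates -/

namespace FeatureMDP

variable {S A : Type*} [Fintype S] [DecidableEq S] [Fintype A] {d : ℕ}

lemma finite_history (M : FeatureMDP S A d) (π : ℕ → Policy S A) (t : ℕ) :
    (M.history π t).Finite :=
  (Set.finite_Icc 1 t).image _

lemma sf_mem_history (M : FeatureMDP S A d) (π : ℕ → Policy S A) {i t : ℕ} (hi : 1 ≤ i)
    (hit : i ≤ t) : M.sf (π i) ∈ M.history π t :=
  ⟨i, ⟨hi, hit⟩, rfl⟩

lemma history_nonempty (M : FeatureMDP S A d) (π : ℕ → Policy S A) {t : ℕ} (ht : 1 ≤ t) :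
    (M.history π t).Nonempty :=
  ⟨_, M.sf_mem_history π le_rfl ht⟩

lemma history_mono (M : FeatureMDP S A d) (π : ℕ → Policy S A) {t t' : ℕ} (h : t ≤ t') :
    M.history π t ⊆ M.history π t' :=
  Set.image_mono (Set.Icc_subset_Icc_right h)

lemma isGreedy_smul_iff (M : FeatureMDP S A d) {c : ℝ} (hc : 0 < c)
    (w : EuclideanSpace ℝ (Fin d)) (π : Policy S A) :
    M.IsGreedy (c • w) π ↔ M.IsGreedy w π := by
  simp only [IsGreedy, real_inner_smul_right, mul_le_mul_iff_right₀ hc]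

lemma isGreedy_neg_normalize_iff (M : FeatureMDP S A d) {x : EuclideanSpace ℝ (Fin d)}
    (hx : x ≠ 0) (π : Policy S A) :
    M.IsGreedy (-(‖x‖⁻¹ • x)) π ↔ M.IsGreedy (-x) π := by
  rw [← smul_neg, M.isGreedy_smul_iff (inv_pos.2 (norm_pos_iff.2 hx))]

/-- A linear reward is maximized by some deterministic policy. -/
lemma HasLimitDistributions.exists_isGreedy_isDeterministic [Nonempty A] {M : FeatureMDP S A d}
    (hM : M.HasLimitDistributions) (w : EuclideanSpace ℝ (Fin d)) :
    ∃ π : Policy S A, π.IsDeterministic ∧ M.IsGreedy w π := by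
  obtain ⟨_, ⟨π, hπ, rfl⟩, hmax⟩ :=
    Set.exists_max_image M.detSF (fun ψ => ⟪ψ, w⟫) M.finite_detSF M.detSF_nonempty
  exact ⟨π, hπ, fun π' => inner_le_of_mem_convexHull hmax (hM.sf_mem_convexHull_detSF π')⟩

lemma history_succ (M : FeatureMDP S A d) (π : ℕ → Policy S A) (t : ℕ) :
    M.history π (t + 1) = insert (M.sf (π (t + 1))) (M.history π t) := by
  have h : Set.Icc 1 (t + 1) = insert (t + 1) (Set.Icc 1 t) := by
    ext i
    simp only [Set.mem_Icc, Set.mem_insert_iff]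
    lia
  rw [history, h, Set.image_insert_eq]
  rfl

/-- The worst-case-reward procedure never gets stuck, and can be run with deterministic policies
after the first. -/
lemma HasLimitDistributions.exists_worstCaseRun [Nonempty A] {M : FeatureMDP S A d}
    (hM : M.HasLimitDistributions) (π₁ : Policy S A) :
    ∃ π : ℕ → Policy S A, π 1 = π₁ ∧ (∀ T, M.IsWorstCaseRun π T) ∧
      ∀ t, 2 ≤ t → (π t).IsDeterministic := by
  have hstep : ∀ Ψ : Set (EuclideanSpace ℝ (Fin d)), ∃ π : Policy S A, π.IsDeterministic ∧
      (Ψ.Finite → Ψ.Nonempty → ∃ w, IsWorstReward Ψ w ∧ M.IsGreedy w π) := fun Ψ => by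
    by_cases h : ∃ w, IsWorstReward Ψ w
    · obtain ⟨w, hw⟩ := h
      obtain ⟨π, hπ, hg⟩ := hM.exists_isGreedy_isDeterministic w
      exact ⟨π, hπ, fun _ _ => ⟨w, hw, hg⟩⟩
    · obtain ⟨π, hπ, -⟩ := hM.exists_isGreedy_isDeterministic 0
      exact ⟨π, hπ, fun h1 h2 => (h (exists_isWorstReward h1 h2)).elim⟩
  choose next hdet hnext using hstep
  -- The recursion carries the set of successor features seen so far along with the last policy.
  let state : ℕ → Set (EuclideanSpace ℝ (Fin d)) × Policy S A := fun n =>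
    Nat.rec ({M.sf π₁}, π₁) (fun _ p => (insert (M.sf (next p.1)) p.1, next p.1)) n
  let π : ℕ → Policy S A := fun t => (state (t - 1)).2
  have hhist : ∀ n, M.history π (n + 1) = (state n).1 := fun n => by
    induction n with
    | zero =>
      rw [history_succ]
      simp [history, π, state]
    | succ n ih =>
      rw [history_succ, ih]
      rfl
  refine ⟨π, rfl, fun T t ht _ => ?_, fun t ht => ?_⟩
  · obtain ⟨n, rfl⟩ := Nat.exists_eq_add_of_le' ht
    have := hnext (M.history π (n + 1)) (M.finite_history _ _) (M.history_nonempty π ht)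
    rw [hhist] at this ⊢
    exact this
  · obtain ⟨n, rfl⟩ := Nat.exists_eq_add_of_le' ht
    exact hdet _

/-- As long as the least-norm point is not the origin, a policy is a possible next iterate of the
worst-case-reward procedure if and only if it is greedy for minus that point. -/
lemma exists_isWorstReward_and_isGreedy_iff (M : FeatureMDP S A d)
    {Ψ : Set (EuclideanSpace ℝ (Fin d))} (hΨ : Ψ.Finite) (hne : Ψ.Nonempty)
    {x : EuclideanSpace ℝ (Fin d)} (hx : IsCorrective halfSq Ψ x) (hx0 : x ≠ 0)
    (π : Policy S A) :
    (∃ w, IsWorstReward Ψ w ∧ M.IsGreedy w π) ↔ M.IsGreedy (-x) π := by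
  simp only [hx.isWorstReward_iff_eq hΨ hne hx0, exists_eq_left, M.isGreedy_neg_normalize_iff hx0]

lemma exists_isCorrective_halfSq_and_isGreedy_iff (M : FeatureMDP S A d)
    {Ψ : Set (EuclideanSpace ℝ (Fin d))} {x : EuclideanSpace ℝ (Fin d)}
    (hx : IsCorrective halfSq Ψ x) (π : Policy S A) :
    (∃ y, IsCorrective halfSq Ψ y ∧ M.IsGreedy (-gradient halfSq y) π) ↔
      M.IsGreedy (-x) π := by
  simp only [gradient_halfSq]
  exact ⟨fun ⟨y, hy, h⟩ => hx.unique hy ▸ h, fun h => ⟨x, hx, h⟩⟩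

lemma exists_isCorrective_norm_and_isGreedy_iff (M : FeatureMDP S A d)
    {Ψ : Set (EuclideanSpace ℝ (Fin d))} {x : EuclideanSpace ℝ (Fin d)}
    (hx : IsCorrective halfSq Ψ x) (hx0 : x ≠ 0) (π : Policy S A) :
    (∃ y, IsCorrective (fun x => ‖x‖) Ψ y ∧ M.IsGreedy (-gradient (fun x => ‖x‖) y) π) ↔
      M.IsGreedy (-x) π := by
  simp only [isCorrective_norm_iff]
  rw [← M.isGreedy_neg_normalize_iff hx0, ← gradient_norm hx0]
  exact ⟨fun ⟨y, hy, h⟩ => hx.unique hy ▸ h, fun h => ⟨x, hx, h⟩⟩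

lemma isWorstCaseRun_iff_isFrankWolfeRun (M : FeatureMDP S A d) (π : ℕ → Policy S A) (T : ℕ)
    (h0 : ∀ t, 1 ≤ t → t < T →
      (0 : EuclideanSpace ℝ (Fin d)) ∉ convexHull ℝ (M.history π t)) :
    (M.IsWorstCaseRun π T ↔ M.IsFrankWolfeRun halfSq π T) ∧
      (M.IsWorstCaseRun π T ↔ M.IsFrankWolfeRun (fun x => ‖x‖) π T) := by
  have key : ∀ t, 1 ≤ t → t < T → ∃ x, IsCorrective halfSq (M.history π t) x ∧ x ≠ 0 := by
    intro t ht htT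
    obtain ⟨x, hx⟩ := exists_isCorrective_halfSq (M.finite_history π t) (M.history_nonempty π ht)
    exact ⟨x, hx, fun h => h0 t ht htT (h ▸ hx.1)⟩
  constructor <;> refine forall_congr' fun t => forall₂_congr fun ht htT => ?_ <;>
    obtain ⟨x, hx, hx0⟩ := key t ht htT <;>
    rw [M.exists_isWorstReward_and_isGreedy_iff (M.finite_history π t)
      (M.history_nonempty π ht) hx hx0]
  · rw [M.exists_isCorrective_halfSq_and_isGreedy_iff hx]
  · rw [M.exists_isCorrective_norm_and_isGreedy_iff hx hx0]

/-- A step of either algorithm that does not start at the origin is greedy for minus the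
least-norm point. -/
lemma isGreedy_neg_of_run {M : FeatureMDP S A d} {π : ℕ → Policy S A} {T : ℕ}
    (h : M.IsWorstCaseRun π T ∨ M.IsFrankWolfeRun halfSq π T) {t : ℕ} (ht : 1 ≤ t) (htT : t < T)
    {x : EuclideanSpace ℝ (Fin d)} (hx : IsCorrective halfSq (M.history π t) x) (hx0 : x ≠ 0) :
    M.IsGreedy (-x) (π (t + 1)) := by
  rcases h with h | h
  · exact (M.exists_isWorstReward_and_isGreedy_iff (M.finite_history π t)
      (M.history_nonempty π ht) hx hx0 _).1 (h t ht htT)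
  · exact (M.exists_isCorrective_halfSq_and_isGreedy_iff hx _).1 (h t ht htT)

lemma HasLimitDistributions.convexHull_history_subset [Nonempty A] {M : FeatureMDP S A d}
    (hM : M.HasLimitDistributions) (π : ℕ → Policy S A) (t : ℕ) :
    convexHull ℝ (M.history π t) ⊆ convexHull ℝ M.detSF := by
  refine convexHull_min ?_ (convex_convexHull ℝ _)
  rintro _ ⟨i, -, rfl⟩
  exact hM.sf_mem_convexHull_detSF _

/-- Optimality over all policies is optimality over the polytope. -/
lemma HasLimitDistributions.isEpsOptimal_zero_iff [Nonempty A] {M : FeatureMDP S A d}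
    (hM : M.HasLimitDistributions) {x : EuclideanSpace ℝ (Fin d)} :
    M.IsEpsOptimal (fun y => ‖y‖) 0 x ↔ ∀ y ∈ convexHull ℝ M.detSF, ‖x‖ ≤ ‖y‖ := by
  simp only [IsEpsOptimal, add_zero, ← hM.range_sf, Set.forall_mem_range]

/-- The stopping test certifies optimality, since `‖ψ‖ ≥ -⟨ψ, w⟩ ≥ ‖x‖` for all achievable `ψ`. -/
lemma isEpsOptimal_of_inner_le_worstValue {M : FeatureMDP S A d}
    {Ψ : Set (EuclideanSpace ℝ (Fin d))} (hΨ : Ψ.Finite)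
    (hne : Ψ.Nonempty) {x w : EuclideanSpace ℝ (Fin d)} (hx : IsCorrective halfSq Ψ x)
    (hw : IsWorstReward Ψ w) {π' : Policy S A} (hπ' : M.IsGreedy w π')
    (htest : ⟪M.sf π', w⟫ ≤ worstValue Ψ) : M.IsEpsOptimal (fun y => ‖y‖) 0 x := by
  intro π
  rw [hx.worstValue_eq hΨ hne] at htest
  have h1 := (hπ' π).trans htest
  have h2 := (abs_le.1 (abs_real_inner_le_norm (M.sf π) w)).1
  have h3 := ((hx.isWorstReward_iff hΨ hne).1 hw).1
  simp only [add_zero]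
  nlinarith [norm_nonneg (M.sf π)]

/-- The stopping test succeeds at an optimal `x ≠ 0`.  At `x = 0` a worst-case reward need not be
`-x / ‖x‖`, and the test may fail. -/
lemma HasLimitDistributions.inner_le_worstValue_of_isEpsOptimal [Nonempty A] {M : FeatureMDP S A d}
    (hM : M.HasLimitDistributions) {Ψ : Set (EuclideanSpace ℝ (Fin d))} (hΨ : Ψ.Finite)
    (hne : Ψ.Nonempty) {x w : EuclideanSpace ℝ (Fin d)} (hx : IsCorrective halfSq Ψ x)
    (hxD : x ∈ convexHull ℝ M.detSF) (hx0 : x ≠ 0)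
    (hw : IsWorstReward Ψ w) (hopt : M.IsEpsOptimal (fun y => ‖y‖) 0 x) (π' : Policy S A) :
    ⟪M.sf π', w⟫ ≤ worstValue Ψ := by
  rw [hx.worstValue_eq hΨ hne, (hx.isWorstReward_iff_eq hΨ hne hx0).1 hw]
  have h := sq_norm_le_inner_of_forall_norm_le (convex_convexHull ℝ _) hxD
    (hM.isEpsOptimal_zero_iff.1 hopt) (hM.sf_mem_convexHull_detSF π')
  have hpos : 0 < ‖x‖ := norm_pos_iff.2 hx0
  rw [inner_neg_right, real_inner_smul_right, real_inner_comm, neg_le_neg_iff]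
  calc ‖x‖ = ‖x‖⁻¹ * ‖x‖ ^ 2 := by field_simp
    _ ≤ _ := by gcongr

end FeatureMDP

/-! ### Proper convex combinations and exposed faces -/

section Faces

variable {E : Type*} [NormedAddCommGroup E] [InnerProductSpace ℝ E] {D K : Set E} {V : Finset E}
  {x : E}

lemma exists_isProperCombination (hx : x ∈ convexHull ℝ D) :
    ∃ V : Finset E, (V : Set E) ⊆ D ∧ IsProperCombination V x := by
  classical
  obtain ⟨ι, _, z, w, hz, hind, hw, hw1, hwz⟩ := eq_pos_convex_span_of_mem_convexHull hx
  have hinj := hind.injective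
  refine ⟨Finset.univ.image z, by simpa using hz, Function.extend z w 0, ?_, ?_, ?_⟩
  · simpa [hinj.extend_apply] using hw
  · rw [Finset.sum_image hinj.injOn]
    simpa [hinj.extend_apply] using hw1
  · rw [Finset.sum_image hinj.injOn]
    simpa [hinj.extend_apply] using hwz

lemma IsProperCombination.nonempty (h : IsProperCombination V x) : V.Nonempty := by
  obtain ⟨α, -, h1, -⟩ := h
  rw [Finset.nonempty_iff_ne_empty]
  rintro rfl
  simp at h1

lemma IsProperCombination.mem_convexHull (h : IsProperCombination V x) (hV : (V : Set E) ⊆ D) :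
    x ∈ convexHull ℝ D := by
  obtain ⟨α, h0, h1, h2⟩ := h
  rw [← h2]
  exact (convex_convexHull ℝ D).sum_mem (fun v hv => (h0 v hv).le) h1
    fun v hv => subset_convexHull ℝ D (hV hv)

lemma isProperCombination_singleton (x : E) : IsProperCombination {x} x :=
  ⟨fun _ => 1, by simp, by simp, by simp⟩

/-- A linear functional whose bound over `V` is attained at a proper combination of `V` is constant
on `V`. -/
lemma IsProperCombination.apply_eq (h : IsProperCombination V x) (l : StrongDual ℝ E)
    (hl : ∀ v ∈ V, l v ≤ l x) {v : E} (hv : v ∈ V) : l v = l x := by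
  obtain ⟨α, h0, h1, h2⟩ := h
  have hsum : ∑ v ∈ V, α v * (l x - l v) = 0 := by
    simp_rw [mul_sub, Finset.sum_sub_distrib, ← Finset.sum_mul, h1, one_mul, sub_eq_zero]
    conv_lhs => rw [← h2]
    simp
  rw [Finset.sum_eq_zero_iff_of_nonneg
    fun v hv => mul_nonneg (h0 v hv).le (sub_nonneg.2 (hl v hv))] at hsum
  have := (mul_eq_zero.1 (hsum v hv)).resolve_left (h0 v hv).ne'
  linarith

/-- A face that contains `x` contains the atoms of which `x` is a proper combination. -/
lemma IsExposed.subset_of_isProperCombination (hK : IsExposed ℝ (convexHull ℝ D) K) (hx : x ∈ K)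
    (hV : (V : Set E) ⊆ D) (h : IsProperCombination V x) : (V : Set E) ⊆ K ∩ D := by
  obtain ⟨l, rfl⟩ := hK ⟨x, hx⟩
  intro v hv
  have hvD := subset_convexHull ℝ D (hV hv)
  refine ⟨⟨hvD, fun y hy => ?_⟩, hV hv⟩
  rw [h.apply_eq l (fun u hu => hx.2 u (subset_convexHull ℝ D (hV hu))) hv]
  exact hx.2 y hy

lemma IsExposed.exists_isProperCombination (hK : IsExposed ℝ (convexHull ℝ D) K) (hx : x ∈ K) :
    ∃ V : Finset E, (V : Set E) ⊆ K ∩ D ∧ IsProperCombination V x := by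
  obtain ⟨V, hV, h⟩ := _root_.exists_isProperCombination (hK.subset hx)
  exact ⟨V, hK.subset_of_isProperCombination hx hV h, h⟩

lemma IsExposed.mem_convexHull_inter (hK : IsExposed ℝ (convexHull ℝ D) K) (hx : x ∈ K) :
    x ∈ convexHull ℝ (K ∩ D) := by
  obtain ⟨V, hV, h⟩ := hK.exists_isProperCombination hx
  exact h.mem_convexHull hV

end Faces

/-! ### The pyramidal width -/

section Width

variable {E : Type*} [NormedAddCommGroup E] [InnerProductSpace ℝ E] {D K : Set E} {V : Finset E}
  {x r : E}

lemma pyramidalDirWidth_nonneg (D : Set E) (r x : E) : 0 ≤ pyramidalDirWidth D r x := by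
  refine Real.sInf_nonneg ?_
  rintro _ ⟨V, hV, h, rfl⟩
  obtain ⟨v, hv⟩ := h.nonempty
  exact Real.sSup_nonneg' ⟨0, ⟨v, hV hv, v, hv, by simp⟩, le_rfl⟩

lemma pyramidalWidth_nonneg (D : Set E) : 0 ≤ pyramidalWidth D := by
  refine Real.sInf_nonneg ?_
  rintro _ ⟨K, -, x, -, r, -, -, rfl⟩
  exact pyramidalDirWidth_nonneg _ _ _

lemma pyramidalDirWidth_le (hV : (V : Set E) ⊆ D) (h : IsProperCombination V x) {c : ℝ}
    (hc : ∀ s ∈ D, ∀ v ∈ V, ⟪‖r‖⁻¹ • r, s - v⟫ ≤ c) : pyramidalDirWidth D r x ≤ c := by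
  obtain ⟨v, hv⟩ := h.nonempty
  have hmem : sSup {c | ∃ s ∈ D, ∃ v ∈ V, c = ⟪‖r‖⁻¹ • r, s - v⟫} ≤ c := by
    refine csSup_le ⟨_, v, hV hv, v, hv, rfl⟩ ?_
    rintro _ ⟨s, hs, v, hv, rfl⟩
    exact hc s hs v hv
  unfold pyramidalDirWidth
  refine le_trans (csInf_le ⟨0, ?_⟩ ⟨V, hV, h, rfl⟩) hmem
  rintro _ ⟨V, hV, h, rfl⟩
  obtain ⟨v, hv⟩ := h.nonempty
  exact Real.sSup_nonneg' ⟨0, ⟨v, hV hv, v, hv, by simp⟩, le_rfl⟩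

lemma pyramidalWidth_le (hK : IsExposed ℝ (convexHull ℝ D) K) (hx : x ∈ K) (hr : r ≠ 0) {c : ℝ}
    (hc : 0 ≤ c) {y : E} (hy : y ∈ K) (hry : r = c • (y - x)) :
    pyramidalWidth D ≤ pyramidalDirWidth (K ∩ D) r x := by
  refine csInf_le ⟨0, ?_⟩ ⟨K, hK, x, hx, r, hr, ⟨c, hc, y, hy, hry⟩, rfl⟩
  rintro _ ⟨K, -, x, -, r, -, -, rfl⟩
  exact pyramidalDirWidth_nonneg _ _ _

/-- For fixed sets of atoms the directional widths are bounded away from zero.  All feasible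
directions lie in the polar of the polar of `A - V`, a closed cone that does not depend on the base
point; no nonzero element of it can have nonpositive inner product with all of `A - V`, so
compactness of the unit sphere gives a uniform bound. -/
lemma exists_pos_le_inner_sub [FiniteDimensional ℝ E] (A V : Finset E) :
    ∃ m > 0, ∀ x y r : E, IsProperCombination V x → y ∈ convexHull ℝ (A : Set E) → r ≠ 0 →
      ∀ c : ℝ, 0 ≤ c → r = c • (y - x) → ∃ s ∈ A, ∃ v ∈ V, m ≤ ⟪‖r‖⁻¹ • r, s - v⟫ := by
  set P : Set E := {z | ∀ s ∈ A, ∀ v ∈ V, ⟪z, s - v⟫ ≤ 0}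
  set T : Set E := {u | ∀ z ∈ P, ⟪z, u⟫ ≤ 0} ∩ Metric.sphere 0 1
  have hTc : IsCompact T := by
    refine (isCompact_sphere 0 1).inter_left ?_
    simp only [Set.ofPred_forall]
    exact isClosed_biInter fun z _ => isClosed_le (by fun_prop) continuous_const
  have hTpos : ∀ u ∈ T, ∃ p ∈ A ×ˢ V, 0 < ⟪u, p.1 - p.2⟫ := fun u hu => by
    by_contra! h
    have huP : u ∈ P := fun s hs v hv => h (s, v) (Finset.mk_mem_product hs hv)
    have h1 := hu.1 u huP
    rw [real_inner_self_eq_norm_sq, mem_sphere_zero_iff_norm.1 hu.2] at h1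
    norm_num at h1
  have hmem : ∀ x y r : E, IsProperCombination V x → y ∈ convexHull ℝ (A : Set E) → r ≠ 0 →
      ∀ c : ℝ, 0 ≤ c → r = c • (y - x) → ‖r‖⁻¹ • r ∈ T := by
    intro x y r hx hy hr c hc hry
    refine ⟨fun z hz => ?_, by simp [norm_smul, hr]⟩
    have h1 : ⟪z, y - x⟫ ≤ 0 := by
      have h2 : ∀ v ∈ V, ⟪y, z⟫ ≤ ⟪v, z⟫ := fun v hv => by
        have hA : ∀ s ∈ (A : Set E), ⟪s, z⟫ ≤ ⟪v, z⟫ := fun s hs => by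
          have := hz s hs v hv
          rw [inner_sub_right, real_inner_comm, real_inner_comm v] at this
          linarith
        exact inner_le_of_mem_convexHull hA hy
      obtain ⟨α, h0, h1, rfl⟩ := hx
      rw [inner_sub_right, inner_sum, real_inner_comm, sub_nonpos]
      calc ⟪y, z⟫ = ∑ v ∈ V, α v * ⟪y, z⟫ := by rw [← Finset.sum_mul, h1, one_mul]
        _ ≤ ∑ v ∈ V, α v * ⟪v, z⟫ :=
          Finset.sum_le_sum fun v hv => mul_le_mul_of_nonneg_left (h2 v hv) (h0 v hv).le
        _ = _ := Finset.sum_congr rfl fun v _ => by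
          rw [real_inner_smul_right, real_inner_comm]
    rw [real_inner_smul_right, hry, real_inner_smul_right]
    exact mul_nonpos_of_nonneg_of_nonpos (by positivity)
      (mul_nonpos_of_nonneg_of_nonpos hc h1)
  rcases T.eq_empty_or_nonempty with hT0 | hTne
  · exact ⟨1, one_pos, fun x y r hx hy hr c hc hry =>
      absurd (hmem x y r hx hy hr c hc hry) (by simp [hT0])⟩
  · have hne : (A ×ˢ V).Nonempty := by
      obtain ⟨u, hu⟩ := hTne
      obtain ⟨p, hp, -⟩ := hTpos u hu
      exact ⟨p, hp⟩
    obtain ⟨u, hu, hmin⟩ := hTc.exists_isMinOn hTne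
      (f := fun u => (A ×ˢ V).sup' hne fun p => ⟪u, p.1 - p.2⟫)
      (Continuous.continuousOn (Continuous.finset_sup'_apply hne fun p _ => by fun_prop))
    refine ⟨(A ×ˢ V).sup' hne fun p => ⟪u, p.1 - p.2⟫, ?_, fun x y r hx hy hr c hc hry => ?_⟩
    · obtain ⟨p, hp, h0⟩ := hTpos u hu
      exact (Finset.lt_sup'_iff hne).2 ⟨p, hp, h0⟩
    · obtain ⟨p, hp, h1⟩ := (Finset.le_sup'_iff hne).1
        (isMinOn_iff.1 hmin _ (hmem x y r hx hy hr c hc hry))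
      rw [Finset.mem_product] at hp
      exact ⟨p.1, hp.1, p.2, hp.2, h1⟩

lemma pyramidalWidth_pos [FiniteDimensional ℝ E] (hD : D.Finite) (hD2 : D.Nontrivial) :
    0 < pyramidalWidth D := by
  have hev : ∀ᶠ m : ℝ in 𝓝[>] 0, ∀ A ∈ hD.toFinset.powerset, ∀ V ∈ hD.toFinset.powerset,
      ∀ x y r : E, IsProperCombination V x → y ∈ convexHull ℝ (A : Set E) → r ≠ 0 →
      ∀ c : ℝ, 0 ≤ c → r = c • (y - x) → ∃ s ∈ A, ∃ v ∈ V, m ≤ ⟪‖r‖⁻¹ • r, s - v⟫ := by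
    rw [Filter.eventually_all_finset]
    intro A _
    rw [Filter.eventually_all_finset]
    intro V _
    obtain ⟨m₀, hm₀, h⟩ := exists_pos_le_inner_sub A V
    filter_upwards [Ioo_mem_nhdsGT hm₀] with m hm x y r hx hy hr c hc hry
    obtain ⟨s, hs, v, hv, hsv⟩ := h x y r hx hy hr c hc hry
    exact ⟨s, hs, v, hv, hm.2.le.trans hsv⟩
  obtain ⟨m, hm, hm0⟩ := (hev.and self_mem_nhdsWithin).exists
  refine lt_of_lt_of_le hm0 (le_csInf ?_ ?_)
  · obtain ⟨x, hx, y, hy, hxy⟩ := hD2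
    exact ⟨_, convexHull ℝ D, IsExposed.refl _, x, subset_convexHull ℝ D hx, y - x,
      sub_ne_zero.2 hxy.symm, ⟨1, zero_le_one, y, subset_convexHull ℝ D hy, by simp⟩, rfl⟩
  · rintro _ ⟨K, hK, x, hx, r, hr, ⟨c, hc, y, hy, hry⟩, rfl⟩
    have hfin : (K ∩ D).Finite := hD.inter_of_right K
    obtain ⟨V₀, hV₀, h₀⟩ := hK.exists_isProperCombination hx
    refine le_csInf ⟨_, V₀, hV₀, h₀, rfl⟩ ?_
    rintro _ ⟨V, hV, h, rfl⟩
    obtain ⟨s, hs, v, hv, hsv⟩ := hm hfin.toFinset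
      (Finset.mem_powerset.2 (Set.Finite.toFinset_subset_toFinset.2 Set.inter_subset_right)) V
      (Finset.mem_powerset.2 fun v hv => hD.mem_toFinset.2 (hV hv).2) x y r h
      (by simpa using hK.mem_convexHull_inter hy) hr c hc hry
    refine hsv.trans (le_csSup ?_ ⟨s, hfin.mem_toFinset.1 hs, v, hv, rfl⟩)
    refine ((hfin.prod V.finite_toSet).image
      fun p : E × E => ⟪‖r‖⁻¹ • r, p.1 - p.2⟫).bddAbove.mono ?_
    rintro _ ⟨s, hs, v, hv, rfl⟩
    exact ⟨(s, v), ⟨hs, hv⟩, rfl⟩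

/-- The scaling inequality of the pyramidal width: for an arbitrary direction `r`, the pairwise gap
`max ⟨r, s - v⟩` is at least the pyramidal width times the slope of `r` along any feasible
displacement `e` of `x`.

The width only speaks of directions that are feasible in a face, so `r` is replaced by its
projection onto the cone of feasible directions at `x`.  Projecting `x + τ r` onto the polytope for
small `τ > 0` yields this projection up to scaling: the residual exposes a face that contains the
projected point `y`, and since there are finitely many faces, a face meeting points close enough to
`x` contains `x`.  On this face the residual is constant, so `r` and `y - x` have proportional
inner products with differences of its points. -/
lemma pyramidalWidth_mul_inner_le (hD : D.Finite) (hx : x ∈ convexHull ℝ D)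
    (hV : (V : Set E) ⊆ D) (h : IsProperCombination V x) {e : E} (he : x + e ∈ convexHull ℝ D)
    (hre : 0 < ⟪r, e⟫) {c : ℝ} (hc : ∀ s ∈ D, ∀ v ∈ V, ⟪r, s - v⟫ ≤ c) :
    pyramidalWidth D * ⟪r, e⟫ ≤ ‖e‖ * c := by
  have hcpt : IsCompact (convexHull ℝ D) := hD.isCompact_convexHull ℝ
  have hev : ∀ᶠ y in 𝓝 x, ∀ G ∈ {G | G ⊆ D}, y ∈ convexHull ℝ G → x ∈ convexHull ℝ G := by
    rw [Filter.eventually_all_finite hD.finite_subsets]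
    intro G hG
    by_cases hxG : x ∈ convexHull ℝ G
    · exact Eventually.of_forall fun _ _ => hxG
    · filter_upwards [((hD.subset hG).isClosed_convexHull ℝ).isOpen_compl.mem_nhds hxG]
        with y hy hy' using absurd hy' hy
  obtain ⟨ε, hε, hball⟩ := Metric.eventually_nhds_iff.1 hev
  set τ : ℝ := ε / (‖r‖ + 1) with hτ
  have hr1 : 0 < ‖r‖ + 1 := by positivity
  have hτ0 : 0 < τ := by positivity
  have hτr : τ * ‖r‖ < ε := by
    rw [hτ, div_mul_eq_mul_div, div_lt_iff₀ hr1]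
    nlinarith
  obtain ⟨y, hy, hyu⟩ := exists_norm_eq_iInf_of_complete_convex ⟨x, hx⟩ hcpt.isComplete
    (convex_convexHull ℝ D) (x + τ • r)
  rw [norm_eq_iInf_iff_real_inner_le_zero (convex_convexHull ℝ D) hy] at hyu
  set q : E := x + τ • r - y with hq
  have hqr : ∀ z, ⟪q, z⟫ = τ * ⟪r, z⟫ - ⟪y - x, z⟫ := fun z => by
    rw [← real_inner_smul_left, ← inner_sub_left]
    congr 1
    rw [hq]
    abel
  have hnear : dist y x < ε := by
    have h1 := hyu x hx
    rw [← neg_sub y x, inner_neg_right, hqr, real_inner_self_eq_norm_sq] at h1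
    have h2 := real_inner_le_norm r (y - x)
    have h3 : ‖y - x‖ * ‖y - x‖ ≤ τ * ‖r‖ * ‖y - x‖ := by nlinarith
    rw [dist_eq_norm]
    rcases (norm_nonneg (y - x)).eq_or_lt with h0 | h0
    · rwa [← h0]
    · exact (le_of_mul_le_mul_right h3 h0).trans_lt hτr
  set K : Set E := (innerSL ℝ q).toExposed (convexHull ℝ D)
  have hK : IsExposed ℝ (convexHull ℝ D) K := ContinuousLinearMap.toExposed.isExposed
  have hyK : y ∈ K := ⟨hy, fun w hw => by
    have := hyu w hw
    rw [inner_sub_right] at this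
    simpa using this⟩
  have hxK : x ∈ K := by
    have h1 := hball hnear (K ∩ D) Set.inter_subset_right (hK.mem_convexHull_inter hyK)
    exact convexHull_min Set.inter_subset_left (hK.convex (convex_convexHull ℝ D)) h1
  have hqK : ∀ z ∈ K, ⟪q, z⟫ = ⟪q, x⟫ := fun z hz => by
    simpa using le_antisymm (hxK.2 z hz.1) (hz.2 x hxK.1)
  have hVK := hK.subset_of_isProperCombination hxK hV h
  have hslope : τ * ⟪r, e⟫ ≤ ‖y - x‖ * ‖e‖ := by
    have h1 : ⟪q, x + e⟫ ≤ ⟪q, x⟫ := by simpa using hxK.2 _ he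
    rw [inner_add_right, add_le_iff_nonpos_right, hqr] at h1
    linarith [real_inner_le_norm (y - x) e]
  have hne : y - x ≠ 0 := fun h0 => by
    rw [h0, norm_zero, zero_mul] at hslope
    exact (mul_pos hτ0 hre).not_ge hslope
  have hpos : 0 < ‖y - x‖ := norm_pos_iff.2 hne
  have hwidth : pyramidalWidth D ≤ ‖y - x‖⁻¹ * (τ * c) := by
    refine (pyramidalWidth_le hK hxK hne zero_le_one hyK (one_smul ℝ _).symm).trans
      (pyramidalDirWidth_le hVK h fun s hs v hv => ?_)
    rw [real_inner_smul_left]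
    gcongr
    have h1 : ⟪q, s - v⟫ = 0 := by
      rw [inner_sub_right, hqK s hs.1, hqK v (hVK hv).1, sub_self]
    rw [hqr] at h1
    have := mul_le_mul_of_nonneg_left (hc s hs.2 v hv) hτ0.le
    linarith
  have hwidth' : pyramidalWidth D * ‖y - x‖ ≤ τ * c := by
    rwa [← div_eq_inv_mul, le_div_iff₀ hpos] at hwidth
  refine le_of_mul_le_mul_left ?_ hτ0
  calc τ * (pyramidalWidth D * ⟪r, e⟫) = pyramidalWidth D * (τ * ⟪r, e⟫) := by ring
    _ ≤ pyramidalWidth D * (‖y - x‖ * ‖e‖) :=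
      mul_le_mul_of_nonneg_left hslope (pyramidalWidth_nonneg D)
    _ = pyramidalWidth D * ‖y - x‖ * ‖e‖ := by ring
    _ ≤ τ * c * ‖e‖ := by gcongr
    _ = τ * (‖e‖ * c) := by ring

lemma pyramidalWidth_le_diam (hD : D.Finite) :
    pyramidalWidth D ≤ Metric.diam (convexHull ℝ D) := by
  rcases D.subsingleton_or_nontrivial with h | ⟨x, hx, y, hy, hxy⟩
  · have : pyramidalWidth D = 0 := by
      have h2 : (convexHull ℝ D).Subsingleton := by
        rcases h.eq_empty_or_singleton with rfl | ⟨a, rfl⟩ <;> simp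
      rw [pyramidalWidth, ← Real.sInf_empty]
      congr 1
      refine Set.eq_empty_of_forall_notMem ?_
      rintro _ ⟨K, hK, x, hx, r, hr, ⟨c, -, y, hy, hry⟩, -⟩
      exact hr (by rw [hry, h2 (hK.subset hy) (hK.subset hx), sub_self, smul_zero])
    rw [this]
    exact Metric.diam_nonneg
  · have hxD := subset_convexHull ℝ D hx
    have hyD := subset_convexHull ℝ D hy
    have hne : y - x ≠ 0 := sub_ne_zero.2 hxy.symm
    refine (pyramidalWidth_le (IsExposed.refl _) hxD hne zero_le_one hyD
      (one_smul ℝ _).symm).trans (pyramidalDirWidth_le (V := {x}) ?_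
        (isProperCombination_singleton x) fun s hs v hv => ?_)
    · simpa using ⟨hxD, hx⟩
    · refine (real_inner_le_norm _ _).trans ?_
      rw [norm_smul, norm_inv, norm_norm, inv_mul_cancel₀ (norm_ne_zero_iff.2 hne), one_mul,
        ← dist_eq_norm, Finset.mem_singleton.1 hv]
      exact Metric.dist_le_diam_of_mem (hD.isCompact_convexHull ℝ).isBounded hs.1 hxD

end Width

namespace FeatureMDP

variable {S A : Type*} [Fintype S] [DecidableEq S] [Fintype A] {d : ℕ}

/-! ### Finite termination -/

/-- Either algorithm reaches the optimum after at most `2 ^ |D|` steps, where `D` is the set of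
successor features of deterministic policies.

The atoms that minimize `⟨x_t, ·⟩` over `D` span a face that contains the next successor features.
If the same set of minimizing atoms occurred at two times `i < j`, then the successor features added
after step `i` would minimize `⟨x_j, ·⟩` over the whole polytope and belong to the history at time
`j`, so that `x_j`, which is optimal over the history, would be optimal over the polytope. -/
lemma HasLimitDistributions.isEpsOptimal_of_two_pow_card_lt [Nonempty A] {M : FeatureMDP S A d}
    (hM : M.HasLimitDistributions) {π : ℕ → Policy S A} {T : ℕ}
    (hrun : M.IsWorstCaseRun π T ∨ M.IsFrankWolfeRun halfSq π T) {t : ℕ} (htT : t ≤ T)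
    (ht : 2 ^ M.finite_detSF.toFinset.card < t) {x : EuclideanSpace ℝ (Fin d)}
    (hx : IsCorrective halfSq (M.history π t) x) : M.IsEpsOptimal (fun y => ‖y‖) 0 x := by
  classical
  have hex : ∀ i, ∃ y, 1 ≤ i → IsCorrective halfSq (M.history π i) y := fun i => by
    by_cases hi : 1 ≤ i
    · obtain ⟨y, hy⟩ := exists_isCorrective_halfSq (M.finite_history π i) (M.history_nonempty π hi)
      exact ⟨y, fun _ => hy⟩
    · exact ⟨0, fun h => (hi h).elim⟩
  choose X hX using hex
  rw [hM.isEpsOptimal_zero_iff]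
  -- an optimum reached earlier is kept
  have hkeep : ∀ i, 1 ≤ i → i ≤ t → (∀ y ∈ convexHull ℝ M.detSF, ‖X i‖ ≤ ‖y‖) →
      ∀ y ∈ convexHull ℝ M.detSF, ‖x‖ ≤ ‖y‖ := fun i hi hit h y hy =>
    (hx.norm_le (convexHull_mono (M.history_mono π hit) (hX i hi).1)).trans (h y hy)
  by_contra hopt
  let G : ℕ → Finset (EuclideanSpace ℝ (Fin d)) := fun i =>
    M.finite_detSF.toFinset.filter fun v => ∀ u ∈ M.detSF, ⟪X i, v⟫ ≤ ⟪X i, u⟫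
  obtain ⟨i, hi, j, hj, hij, hG⟩ := Finset.exists_ne_map_eq_of_card_lt_of_maps_to
    (s := Finset.Icc 1 t) (t := M.finite_detSF.toFinset.powerset) (f := G)
    (by simpa using ht)
    (fun i _ => by
      simpa only [Finset.mem_coe, Finset.mem_powerset] using Finset.filter_subset _ _)
  wlog hlt : i < j generalizing i j
  · exact this j hj i hi hij.symm hG.symm (by lia)
  rw [Finset.mem_Icc] at hi hj
  have hXi := hX i hi.1
  have hXj := hX j hj.1
  have hXi0 : X i ≠ 0 := fun h0 => hopt (hkeep i hi.1 hi.2 (by simp [h0]))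
  have hgreedy := isGreedy_neg_of_run hrun hi.1 (by lia) hXi hXi0
  set ψ := M.sf (π (i + 1))
  have hψK : ψ ∈ (innerSL ℝ (-X i)).toExposed (convexHull ℝ M.detSF) := by
    refine ⟨hM.sf_mem_convexHull_detSF _, fun y hy => ?_⟩
    rw [← hM.range_sf] at hy
    obtain ⟨π', rfl⟩ := hy
    simpa only [innerSL_apply_apply, real_inner_comm] using hgreedy π'
  have hψG : ψ ∈ convexHull ℝ (G j : Set (EuclideanSpace ℝ (Fin d))) := by
    rw [← hG]
    refine convexHull_mono ?_
      (ContinuousLinearMap.toExposed.isExposed.mem_convexHull_inter hψK)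
    rintro v ⟨hvK, hvD⟩
    simp only [G, Finset.coe_filter, Set.Finite.mem_toFinset, Set.mem_ofPred_eq]
    refine ⟨hvD, fun u hu => ?_⟩
    simpa using hvK.2 u (subset_convexHull ℝ _ hu)
  have hψj : ‖X j‖ ^ 2 ≤ ⟪X j, ψ⟫ :=
    hXj.sq_norm_le_inner (subset_convexHull ℝ _ (M.sf_mem_history π (by lia) (by lia)))
  have hmin : ∀ u ∈ M.detSF, ⟪ψ, X j⟫ ≤ ⟪u, X j⟫ := fun u hu => by
    refine inner_le_of_mem_convexHull (fun v hv => ?_) hψG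
    rw [real_inner_comm, real_inner_comm _ u]
    exact (Finset.mem_filter.1 (Finset.mem_coe.1 hv)).2 u hu
  refine hopt (hkeep j hj.1 hj.2 fun y hy => norm_le_of_sq_norm_le_inner ?_)
  have hy' : ⟪y, -X j⟫ ≤ -‖X j‖ ^ 2 := inner_le_of_mem_convexHull (fun u hu => by
    rw [inner_neg_right, neg_le_neg_iff]
    exact (hψj.trans_eq (real_inner_comm _ _)).trans (hmin u hu)) hy
  rw [inner_neg_right, real_inner_comm] at hy'
  linarith

lemma IsEpsOptimal.of_zero {M : FeatureMDP S A d} {x : EuclideanSpace ℝ (Fin d)}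
    (h : M.IsEpsOptimal (fun y => ‖y‖) 0 x) {ε : ℝ} (hε : 0 ≤ ε) :
    M.IsEpsOptimal (fun y => ‖y‖) ε x ∧ M.IsEpsOptimal halfSq ε x := by
  simp only [IsEpsOptimal, add_zero] at h
  exact ⟨fun π => (h π).trans (le_add_of_nonneg_right hε),
    fun π => (halfSq_le_halfSq.2 (h π)).trans (le_add_of_nonneg_right hε)⟩

lemma HasLimitDistributions.exists_iteration_bound [Nonempty A] {M : FeatureMDP S A d}
    (hM : M.HasLimitDistributions) :
    ∃ C : ℝ, ∀ ε : ℝ, 0 < ε → ε ≤ 1 / 2 →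
      ∀ (π : ℕ → Policy S A) (T : ℕ), (M.IsWorstCaseRun π T ∨ M.IsFrankWolfeRun halfSq π T) →
        ∀ t, 1 ≤ t → t ≤ T → C * Real.log (1 / ε) ≤ t →
          ∀ x, IsCorrective halfSq (M.history π t) x →
            M.IsEpsOptimal (fun y => ‖y‖) ε x ∧ M.IsEpsOptimal halfSq ε x := by
  set N := 2 ^ M.finite_detSF.toFinset.card + 1
  have hlog : 0 < Real.log 2 := Real.log_pos one_lt_two
  refine ⟨N / Real.log 2, fun ε hε hε2 π T hrun t _ htT ht x hx => ?_⟩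
  refine (hM.isEpsOptimal_of_two_pow_card_lt hrun htT ?_ hx).of_zero hε.le
  -- `log (1 / ε) ≥ log 2`, so the hypothesis on `t` gives `t ≥ N`
  have h1 : Real.log 2 ≤ Real.log (1 / ε) := by
    refine Real.log_le_log two_pos ?_
    rw [le_div_iff₀ hε]
    linarith
  have h2 : (N : ℝ) ≤ t := by
    refine le_trans ?_ ht
    calc (N : ℝ) = N / Real.log 2 * Real.log 2 := (div_mul_cancel₀ _ hlog.ne').symm
      _ ≤ _ := by gcongr
  have h3 : N ≤ t := by exact_mod_cast h2
  lia

/-! ### Geometric decrease -/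

lemma HasLimitDistributions.subopt_eq [Nonempty A] {M : FeatureMDP S A d}
    (hM : M.HasLimitDistributions) {z : EuclideanSpace ℝ (Fin d)}
    (hz : IsCorrective halfSq M.detSF z) (x : EuclideanSpace ℝ (Fin d)) :
    M.subopt x = halfSq x - halfSq z := by
  have hle : ∀ π, halfSq z ≤ halfSq (M.sf π) := fun π =>
    halfSq_le_halfSq.2 (hz.norm_le (hM.sf_mem_convexHull_detSF π))
  obtain ⟨π, rfl⟩ : z ∈ Set.range M.sf := hM.range_sf ▸ hz.1
  have : Nonempty (Policy S A) := ⟨π⟩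
  rw [subopt, le_antisymm (ciInf_le ⟨_, Set.forall_mem_range.2 hle⟩ π) (le_ciInf hle)]

lemma halfSq_add_smul {d : ℕ} (x v : EuclideanSpace ℝ (Fin d)) (γ : ℝ) :
    halfSq (x + γ • v) = halfSq x - γ * ⟪-x, v⟫ + γ ^ 2 * ‖v‖ ^ 2 / 2 := by
  rw [halfSq, halfSq, norm_add_sq_real, real_inner_smul_right, norm_smul, mul_pow, inner_neg_left,
    Real.norm_eq_abs, sq_abs]
  ring

/-- Line search on a segment along which `h` decreases by `γ g - γ² n / 2`, where `n` is the
squared length.  The unconstrained maximum `γ = g / n` is used if it lies on the segment, and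
otherwise the end point `γ = 1`. -/
lemma exists_step_progress {H g n δ Δ : ℝ} (hH : 0 ≤ H) (hg : H ≤ g) (hn : 0 < n)
    (hnΔ : n ≤ Δ ^ 2) (hδ0 : 0 ≤ δ) (hδΔ : δ ≤ Δ) (hδ : 2 * δ ^ 2 * H ≤ g ^ 2) :
    ∃ γ : ℝ, 0 ≤ γ ∧ γ ≤ 1 ∧ δ ^ 2 / (4 * Δ ^ 2) * H ≤ γ * g - γ ^ 2 * n / 2 := by
  have hΔ : 0 < Δ ^ 2 := hn.trans_le hnΔ
  rcases le_or_gt g n with hgn | hgn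
  · refine ⟨g / n, div_nonneg (hH.trans hg) hn.le, (div_le_one hn).2 hgn, ?_⟩
    have h1 : g / n * g - (g / n) ^ 2 * n / 2 = g ^ 2 / (2 * n) := by
      field_simp
      ring
    rw [h1, div_mul_eq_mul_div]
    calc δ ^ 2 * H / (4 * Δ ^ 2) ≤ g ^ 2 / (4 * Δ ^ 2) := by
          gcongr
          nlinarith [mul_nonneg (sq_nonneg δ) hH]
      _ ≤ g ^ 2 / (2 * n) := by
          gcongr
          linarith
  · refine ⟨1, zero_le_one, le_rfl, ?_⟩
    have h1 : δ ^ 2 / (4 * Δ ^ 2) ≤ 1 / 4 := by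
      rw [div_le_iff₀ (by positivity)]
      have := pow_le_pow_left₀ hδ0 hδΔ 2
      linarith
    have h2 := mul_le_mul_of_nonneg_right h1 hH
    linarith

/-- One step decreases the suboptimality geometrically.  As `x` has least norm in the hull of the
history, `⟨x, ·⟩` is constant on the atoms of which `x` is a proper combination, so the Frank–Wolfe
gap `g` coincides with the pairwise gap, which the pyramidal width bounds below by the slope towards
the optimum. -/
lemma HasLimitDistributions.subopt_step [Nonempty A] {M : FeatureMDP S A d}
    (hM : M.HasLimitDistributions) {π : ℕ → Policy S A} {T : ℕ}
    (hrun : M.IsWorstCaseRun π T ∨ M.IsFrankWolfeRun halfSq π T)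
    (hdet : ∀ t, 1 ≤ t → t ≤ T → M.sf (π t) ∈ M.detSF) {t : ℕ} (ht : 1 ≤ t) (htT : t + 1 ≤ T)
    {x y : EuclideanSpace ℝ (Fin d)} (hx : IsCorrective halfSq (M.history π t) x)
    (hy : IsCorrective halfSq (M.history π (t + 1)) y) :
    M.subopt y ≤ (1 - pyramidalWidth M.detSF ^ 2 /
      (4 * Metric.diam (convexHull ℝ M.detSF) ^ 2)) * M.subopt x := by
  obtain ⟨z, hz⟩ := exists_isCorrective_halfSq M.finite_detSF M.detSF_nonempty
  rw [hM.subopt_eq hz, hM.subopt_eq hz]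
  set δ := pyramidalWidth M.detSF
  set Δ := Metric.diam (convexHull ℝ M.detSF)
  have hxD := hM.convexHull_history_subset π t hx.1
  have hxy' := convexHull_mono (M.history_mono π t.le_succ) hx.1
  have hxy : halfSq y ≤ halfSq x := halfSq_le_halfSq.2 (hy.norm_le hxy')
  have hzx : halfSq z ≤ halfSq x := halfSq_le_halfSq.2 (hz.norm_le hxD)
  rcases hzx.eq_or_lt with heq | hlt
  · rw [heq, sub_self, mul_zero]
    linarith
  have hnorm : ‖z‖ < ‖x‖ := lt_of_not_ge fun h => hlt.not_ge (halfSq_le_halfSq.2 h)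
  have hx0 : x ≠ 0 := norm_pos_iff.1 ((norm_nonneg z).trans_lt hnorm)
  have hgreedy := isGreedy_neg_of_run hrun ht (by lia) hx hx0
  have hψ := hdet (t + 1) (by lia) htT
  set ψ := M.sf (π (t + 1))
  have hψmax : ∀ u ∈ convexHull ℝ M.detSF, ⟪-x, u⟫ ≤ ⟪-x, ψ⟫ := fun u hu => by
    rw [← hM.range_sf] at hu
    obtain ⟨π', rfl⟩ := hu
    simpa only [real_inner_comm] using hgreedy π'
  obtain ⟨V, hV, hVx⟩ := exists_isProperCombination hx.1
  have hVD : (V : Set (EuclideanSpace ℝ (Fin d))) ⊆ M.detSF := by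
    intro v hv
    obtain ⟨i, hi, rfl⟩ := hV hv
    exact hdet i hi.1 (by have := hi.2; lia)
  have hVeq : ∀ v ∈ V, ⟪-x, v⟫ = ⟪-x, x⟫ := fun v hv => by
    refine hVx.apply_eq (innerSL ℝ (-x)) (fun u hu => ?_) hv
    have := hx.sq_norm_le_inner (subset_convexHull ℝ _ (hV hu))
    simpa using this
  have hgap : ∀ s ∈ M.detSF, ∀ v ∈ V, ⟪-x, s - v⟫ ≤ ⟪-x, ψ - x⟫ := fun s hs v hv => by
    rw [inner_sub_right, inner_sub_right, hVeq v hv]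
    linarith [hψmax s (subset_convexHull ℝ _ hs)]
  set g := ⟪-x, ψ - x⟫ with hg
  set e := z - x with he
  have hze : x + e = z := by simp [he]
  have hH : halfSq x - halfSq z = ⟪-x, e⟫ - ‖e‖ ^ 2 / 2 := by
    have := halfSq_add_smul x e 1
    rw [one_smul, hze] at this
    linarith
  have ha : 0 < ⟪-x, e⟫ := by nlinarith [sq_nonneg ‖e‖]
  have hag : ⟪-x, e⟫ ≤ g := by
    rw [hg, he, inner_sub_right, inner_sub_right]
    linarith [hψmax z hz.1]
  have hwidth : δ * ⟪-x, e⟫ ≤ ‖e‖ * g :=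
    pyramidalWidth_mul_inner_le M.finite_detSF hxD hVD hVx (hze ▸ hz.1) ha hgap
  have hδ0 : 0 ≤ δ := pyramidalWidth_nonneg _
  have he0 : 0 < ‖e‖ ^ 2 := by
    have : e ≠ 0 := fun h => by simp [h] at ha
    positivity
  have hδH : 2 * δ ^ 2 * (halfSq x - halfSq z) ≤ g ^ 2 := by
    refine le_of_mul_le_mul_left ?_ he0
    -- `‖e‖² (2 a - ‖e‖²) ≤ a²` for the slope `a`
    have h1 : ‖e‖ ^ 2 * (2 * (halfSq x - halfSq z)) ≤ ⟪-x, e⟫ ^ 2 := by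
      rw [hH]
      nlinarith [sq_nonneg (⟪-x, e⟫ - ‖e‖ ^ 2)]
    calc ‖e‖ ^ 2 * (2 * δ ^ 2 * (halfSq x - halfSq z))
        = δ ^ 2 * (‖e‖ ^ 2 * (2 * (halfSq x - halfSq z))) := by ring
      _ ≤ δ ^ 2 * ⟪-x, e⟫ ^ 2 := by gcongr
      _ = (δ * ⟪-x, e⟫) ^ 2 := by ring
      _ ≤ (‖e‖ * g) ^ 2 := pow_le_pow_left₀ (by positivity) hwidth 2
      _ = ‖e‖ ^ 2 * g ^ 2 := by ring
  have hn : 0 < ‖ψ - x‖ ^ 2 := by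
    have : ψ - x ≠ 0 := fun h => by
      rw [hg, h, inner_zero_right] at hag
      linarith
    positivity
  have hnΔ : ‖ψ - x‖ ^ 2 ≤ Δ ^ 2 := by
    rw [← dist_eq_norm]
    exact pow_le_pow_left₀ dist_nonneg (Metric.dist_le_diam_of_mem
      (M.finite_detSF.isCompact_convexHull ℝ).isBounded (subset_convexHull ℝ _ hψ) hxD) 2
  obtain ⟨γ, hγ0, hγ1, hγ⟩ := exists_step_progress (sub_nonneg.2 hzx)
    ((by linarith : halfSq x - halfSq z ≤ ⟪-x, e⟫).trans hag) hn hnΔ hδ0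
    (pyramidalWidth_le_diam M.finite_detSF) hδH
  have hmem : x + γ • (ψ - x) ∈ convexHull ℝ (M.history π (t + 1)) :=
    (convex_convexHull ℝ _).add_smul_sub_mem hxy'
      (subset_convexHull ℝ _ (M.sf_mem_history π (by lia) le_rfl)) ⟨hγ0, hγ1⟩
  have hfinal := halfSq_le_halfSq.2 (hy.norm_le hmem)
  rw [halfSq_add_smul, ← hg] at hfinal
  rw [sub_mul, one_mul]
  linarith

end FeatureMDP

end

theorem lemma2 {S A : Type*} [Fintype S] [DecidableEq S] [Fintype A] [Nonempty A] {d : ℕ}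
    (M : FeatureMDP S A d) (hM : M.HasLimitDistributions) :
    -- the achievable successor features form the polytope spanned by the deterministic policies
    (M.detSF.Finite ∧ Set.range M.sf = convexHull ℝ M.detSF) ∧
    -- the procedure can be run from any initial policy, with deterministic maximizers
    (∀ π₁ : Policy S A, ∃ π : ℕ → Policy S A, π 1 = π₁ ∧ (∀ T, M.IsWorstCaseRun π T) ∧
      ∀ t, 2 ≤ t → (π t).IsDeterministic) ∧
    -- one step: worst-case rewards versus fully corrective steps
    (∀ (π : ℕ → Policy S A) (t : ℕ), 1 ≤ t →
      (∃! x, IsCorrective halfSq (M.history π t) x) ∧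
      ∀ x, IsCorrective halfSq (M.history π t) x →
        worstValue (M.history π t) = -‖x‖ ∧
        (x ≠ 0 →
          (∀ w, IsWorstReward (M.history π t) w ↔ w = -(‖x‖⁻¹ • x)) ∧
          ∀ w, IsWorstReward (M.history π t) w →
            ∀ π', M.IsGreedy w π' ↔ M.IsGreedy (-x) π')) ∧
    -- the iterates of the two algorithms are the same, as long as `x = 0` (which is optimal)
    -- has not been reached
    (∀ (π : ℕ → Policy S A) (T : ℕ),
      (∀ t, 1 ≤ t → t < T → (0 : EuclideanSpace ℝ (Fin d)) ∉ convexHull ℝ (M.history π t)) →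
      (M.IsWorstCaseRun π T ↔ M.IsFrankWolfeRun halfSq π T) ∧
      (M.IsWorstCaseRun π T ↔ M.IsFrankWolfeRun (fun x => ‖x‖) π T)) ∧
    -- the stopping test of the procedure detects optimality
    (∀ (π : ℕ → Policy S A) (t : ℕ), 1 ≤ t → ∀ x, IsCorrective halfSq (M.history π t) x →
      ∀ w, IsWorstReward (M.history π t) w → ∀ π', M.IsGreedy w π' →
        (⟪M.sf π', w⟫ ≤ worstValue (M.history π t) → M.IsEpsOptimal (fun y => ‖y‖) 0 x) ∧
        (x ≠ 0 → M.IsEpsOptimal (fun y => ‖y‖) 0 x →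
          ⟪M.sf π', w⟫ ≤ worstValue (M.history π t))) ∧
    -- `O(log (1 / ε))` iterations suffice for an `ε`-optimal solution
    (∃ C : ℝ, ∀ ε : ℝ, 0 < ε → ε ≤ 1 / 2 →
      ∀ (π : ℕ → Policy S A) (T : ℕ), (M.IsWorstCaseRun π T ∨ M.IsFrankWolfeRun halfSq π T) →
        ∀ t, 1 ≤ t → t ≤ T → C * Real.log (1 / ε) ≤ t →
          ∀ x, IsCorrective halfSq (M.history π t) x →
            M.IsEpsOptimal (fun y => ‖y‖) ε x ∧ M.IsEpsOptimal halfSq ε x) ∧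
    -- geometric decrease at the rate given by the pyramidal width, when the atoms are the
    -- successor features of deterministic policies
    (M.detSF.Nontrivial → 0 < pyramidalWidth M.detSF) ∧
    (∀ (π : ℕ → Policy S A) (T : ℕ), (M.IsWorstCaseRun π T ∨ M.IsFrankWolfeRun halfSq π T) →
      (∀ t, 1 ≤ t → t ≤ T → M.sf (π t) ∈ M.detSF) →
        ∀ t, 1 ≤ t → t + 1 ≤ T → ∀ x y, IsCorrective halfSq (M.history π t) x →
          IsCorrective halfSq (M.history π (t + 1)) y →
            M.subopt y ≤ (1 - pyramidalWidth M.detSF ^ 2 /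
              (4 * Metric.diam (convexHull ℝ M.detSF) ^ 2)) * M.subopt x) := by
  refine ⟨⟨M.finite_detSF, hM.range_sf⟩, hM.exists_worstCaseRun, fun π t ht => ?_,
    M.isWorstCaseRun_iff_isFrankWolfeRun, fun π t ht x hx w hw π' hπ' => ?_,
    hM.exists_iteration_bound, pyramidalWidth_pos M.finite_detSF,
    fun π T hrun hdet t ht htT x y hx hy => hM.subopt_step hrun hdet ht htT hx hy⟩
  · have hfin := M.finite_history π t
    have hne := M.history_nonempty π ht
    refine ⟨?_, fun x hx => ⟨hx.worstValue_eq hfin hne, fun hx0 =>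
      ⟨fun w => hx.isWorstReward_iff_eq hfin hne hx0, fun w hw π' => ?_⟩⟩⟩
    · obtain ⟨x, hx⟩ := exists_isCorrective_halfSq hfin hne
      exact ⟨x, hx, fun y hy => hy.unique hx⟩
    · rw [(hx.isWorstReward_iff_eq hfin hne hx0).1 hw, M.isGreedy_neg_normalize_iff hx0]
  · have hfin := M.finite_history π t
    have hne := M.history_nonempty π ht
    exact ⟨FeatureMDP.isEpsOptimal_of_inner_le_worstValue hfin hne hx hw hπ', fun hx0 hopt =>
      hM.inner_le_worstValue_of_isEpsOptimal hfin hne hx (hM.convexHull_history_subset π t hx.1)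
        hx0 hw hopt π'⟩
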